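/- For an irrational number $x\in(0,1)$ with continued fraction expansion $x=[a_1,a_2,\ldots]=1/(a_1+1/(a_2+\cdots))$, let $q_n(x)$ $(n\ge 1)$ be the denominator of its $n$-th convergent $p_n/q_n=[a_1,\ldots,a_n]$ in lowest terms. Write $\lg=\log_{10}$ and let $\log$ be the natural logarithm. For real $y\neq 0$ let $s(y)$ be its decimal significand, i.e. the unique $t\in[1,10)$ with $|y|=10^k t$ for some $k\in\mathbb Z$. A sequence $(y_n)_{n\ge1}$ of nonzero reals is a Benford sequence if $\lim_{N\to\infty}\frac1N\#\{1\le n\le N: s(y_n)\le t\}=\lg t$ for all $t\in[1,10)$. A sequence $(y_n)_{n\ge1}$ of reals is uniformly distributed mod $1$ if $\lim_{N\to\infty}\frac1N\#\{1\le n\le N:\{y_n\}\le t\}=t$ for all $t\in[0,1)$, where $\{y\}$ is the fractional part of $y$. Theorem. For Lebesgue-almost every $x\in(0,1)$, the sequence $(q_n(x))_{n\ge1}$ is a Benford sequence. Equivalently, for Lebesgue-almost every $x\in(0,1)$, the sequence $(\lg q_n(x))_{n\ge1}$ is uniformly distributed mod $1$; in fact, for every irrational $x\in(0,1)$, $(q_n(x))_{n\ge1}$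 is a Benford sequence if and only if $(\lg q_n(x))_{n\ge1}$ is uniformly distributed mod $1$. Moreover, for Lebesgue-almost every $x\in(0,1)$, the sequence $(\log q_n(x))_{n\ge1}$ is uniformly distributed mod $1$. -/

import Mathlib

noncomputable section

open Filter Topology MeasureTheory

/-- A real sequence, read from the index `1` on, is uniformly distributed mod `1`: for every
`t ∈ [0,1)` the asymptotic proportion of the terms with fractional part at most `t` is `t`. -/
def IsUnifDistribModOne (u : ℕ → ℝ) : Prop :=
  ∀ t ∈ Set.Ico (0 : ℝ) 1,
    Tendsto (fun N : ℕ => (((Finset.Icc 1 N).filter fun n => Int.fract (u n) ≤ t).card : ℝ) / N)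
      atTop (𝓝 t)

/-- The decimal significand of a nonzero real number `x`: the number `t ∈ [1,10)` such that
`|x| = 10 ^ k * t` for some integer `k`. (`Int.log 10 |x|` is the largest `k : ℤ` with
`10 ^ k ≤ |x|`.) -/
def significand (x : ℝ) : ℝ :=
  |x| / (10 : ℝ) ^ (Int.log 10 |x|)

/-- For `x ≠ 0`, the value `significand x` is characterized by its defining property. -/
theorem significand_eq_iff {x : ℝ} (hx : x ≠ 0) (t : ℝ) :
    significand x = t ↔ t ∈ Set.Ico (1 : ℝ) 10 ∧ ∃ k : ℤ, |x| = (10 : ℝ) ^ k * t := by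
  have hpos : 0 < |x| := abs_pos.mpr hx
  constructor
  · rintro rfl
    have h1 := Int.zpow_log_le_self (b := 10) (r := |x|) (by norm_num) hpos
    have h2 := Int.lt_zpow_succ_log_self (b := 10) (by norm_num) |x|
    push_cast at h1 h2
    have h10 : (0 : ℝ) < (10 : ℝ) ^ (Int.log 10 |x|) := by positivity
    refine ⟨⟨(one_le_div h10).mpr h1, ?_⟩, Int.log 10 |x|, ?_⟩
    · rw [significand, div_lt_iff₀ h10]
      rw [zpow_add_one₀ (by norm_num)] at h2
      linarith
    · rw [significand]
      field_simp
  · rintro ⟨⟨h1, h2⟩, k, hk⟩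
    have h10 : (0 : ℝ) < (10 : ℝ) ^ k := by positivity
    have hlog : Int.log 10 |x| = k := by
      apply le_antisymm
      · have h : Int.log 10 |x| < k + 1 := by
          rw [← Int.lt_zpow_iff_log_lt (by norm_num) hpos]
          push_cast
          rw [zpow_add_one₀ (by norm_num), hk]
          gcongr
        omega
      · rw [← Int.zpow_le_iff_le_log (by norm_num) hpos]
        push_cast
        rw [hk]
        nlinarith
    rw [significand, hlog, hk]
    field_simp

/-- A real sequence, read from the index `1` on, is a Benford sequence: for every `t ∈ [1,10)`
the asymptotic proportion of the terms with decimal significand at most `t` is `log₁₀ t`. -/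
def IsBenford (u : ℕ → ℝ) : Prop :=
  ∀ t ∈ Set.Ico (1 : ℝ) 10,
    Tendsto (fun N : ℕ => (((Finset.Icc 1 N).filter fun n => significand (u n) ≤ t).card : ℝ) / N)
      atTop (𝓝 (Real.logb 10 t))

/-- The denominator `q_n(x)` of the `n`-th convergent `p_n/q_n = [a₁, …, a_n]` of the regular
continued fraction of `x`; thus `q₀ = 1`, and `q₁ = a₁` when `x ∈ (0,1)` is irrational. -/
def convDen (x : ℝ) (n : ℕ) : ℝ :=
  (GenContFract.of x).dens n

end

noncomputable section

open Filter Topology MeasureTheory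

/-! By Weyl's criterion it suffices that, for each real t ≠ 0, the averages of q_n^(it) tend to 0
almost everywhere; taking t = 2πkc gives uniform distribution of c·log q_n, with c = 1/log 10 for
`logb 10` (hence Benford) and c = 1 for the natural logarithm.

The ratios r_n = q_{n-1}/q_n form a Markov chain: under Lebesgue measure, given a_1, …, a_n, the
point T^n x has density (1+r)/(1+rx)² with r = r_n. Let L be the transition operator of this chain
weighted by (q_{n+1}/q_n)^(it). Then q_m^(it)·(L^j 1)(r_m) and q_m^(it)·(L^{j+1} 1)(r_m) have sums
over m differing by a martingale with bounded increments plus a bounded term. The martingale is o(N)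
a.e. by an L² bound along squares. So q_m^(it) may be replaced on average by q_m^(it)·(L^k 1)(r_m)
for any fixed k.

It remains to make L^k 1 uniformly small (`exists_norm_iterate_transfer_le`). All iterates share one
Lipschitz constant. On large digits the next ratio is near 0, so the function is nearly constant
there, while the sum of the weighted phases behaves like ∫_u^∞ v^(it-2) dv = u^(it-1)/(1-it). Since
|1-it| > 1, this part loses a fixed proportion, and the sup norm drops at each step until it is
below ε. -/

/-- The character `u ↦ u ^ (i t)` of the positive reals. -/
def twist (t u : ℝ) : ℂ :=
  Complex.exp ((t * Real.log u : ℝ) * Complex.I)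

theorem norm_twist (t u : ℝ) : ‖twist t u‖ = 1 :=
  Complex.norm_exp_ofReal_mul_I _

theorem twist_one (t : ℝ) : twist t 1 = 1 := by
  simp [twist]

theorem twist_mul (t : ℝ) {u v : ℝ} (hu : u ≠ 0) (hv : v ≠ 0) :
    twist t (u * v) = twist t u * twist t v := by
  rw [twist, twist, twist, ← Complex.exp_add, Real.log_mul hu hv]
  congr 1
  push_cast
  ring

theorem twist_eq_mul_exp (t u v : ℝ) :
    twist t u = twist t v * Complex.exp (Complex.I * (t * (Real.log u - Real.log v) : ℝ)) := by
  rw [twist, twist, ← Complex.exp_add]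
  congr 1
  push_cast
  ring

theorem norm_twist_sub_le (t u v : ℝ) :
    ‖twist t u - twist t v‖ ≤ |t| * |Real.log u - Real.log v| := by
  have h : twist t u - twist t v =
      twist t v * (Complex.exp (Complex.I * (t * (Real.log u - Real.log v) : ℝ)) - 1) := by
    rw [twist_eq_mul_exp t u v]
    ring
  rw [h, norm_mul, norm_twist, one_mul, ← abs_mul]
  exact Real.norm_exp_I_mul_ofReal_sub_one_le

theorem abs_log_sub_log_le {u v : ℝ} (hu : 1 ≤ u) (hv : 1 ≤ v) :
    |Real.log u - Real.log v| ≤ |u - v| := by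
  have key : ∀ {u v : ℝ}, 1 ≤ u → 1 ≤ v → Real.log u - Real.log v ≤ |u - v| := by
    intro u v hu hv
    rw [← Real.log_div (by positivity) (by positivity)]
    have h1 := Real.log_le_sub_one_of_pos (x := u / v) (by positivity)
    have h2 : u / v - 1 = (u - v) / v := by field_simp
    rw [h2] at h1
    refine h1.trans ((div_le_div_of_nonneg_right (le_abs_self _) (by positivity)).trans ?_)
    exact div_le_self (abs_nonneg _) hv
  rw [abs_le']
  refine ⟨key hu hv, ?_⟩
  rw [neg_sub, abs_sub_comm]
  exact key hv hu

theorem norm_twist_sub_le_of_one_le (t : ℝ) {u v : ℝ} (hu : 1 ≤ u) (hv : 1 ≤ v) :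
    ‖twist t u - twist t v‖ ≤ |t| * |u - v| :=
  (norm_twist_sub_le t u v).trans
    (mul_le_mul_of_nonneg_left (abs_log_sub_log_le hu hv) (abs_nonneg t))

/-! ### The Markov chain of ratios of consecutive denominators -/

/-- The conditional probability that the next partial quotient is `a + 1` when
`q_{n-1} / q_n = r`. -/
def digitProb (r : ℝ) (a : ℕ) : ℝ :=
  (1 + r) / ((a + 1 + r) * (a + 2 + r))

/-- The value of `q_n / q_{n+1}` when `q_{n-1} / q_n = r` and the next partial quotient is
`a + 1`. -/
def nextRatio (r : ℝ) (a : ℕ) : ℝ :=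
  (a + 1 + r)⁻¹

theorem nextRatio_mem {r : ℝ} (hr : r ∈ Set.Icc (0 : ℝ) 1) (a : ℕ) :
    nextRatio r a ∈ Set.Icc (0 : ℝ) 1 := by
  have := hr.1
  have ha : (0 : ℝ) ≤ a := a.cast_nonneg
  exact ⟨by unfold nextRatio; positivity, inv_le_one_of_one_le₀ (by linarith)⟩

theorem digitProb_nonneg {r : ℝ} (hr : r ∈ Set.Icc (0 : ℝ) 1) (a : ℕ) : 0 ≤ digitProb r a := by
  have := hr.1
  unfold digitProb
  positivity

theorem hasSum_telescope {u : ℝ} (hu : 0 < u) :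
    HasSum (fun j : ℕ => 1 / ((u + j) * (u + j + 1))) (1 / u) := by
  rw [hasSum_iff_tendsto_nat_of_nonneg (fun j => by positivity)]
  have h : ∀ n : ℕ, ∑ j ∈ Finset.range n, 1 / ((u + j) * (u + j + 1)) = 1 / u - 1 / (u + n) := by
    intro n
    induction n with
    | zero => simp
    | succ n ih =>
      rw [Finset.sum_range_succ, ih]
      push_cast
      have h1 : u + n ≠ 0 := by positivity
      have h2 : u + n + 1 ≠ 0 := by positivity
      have h3 : u + (n + 1) ≠ 0 := by positivity
      field_simp
      ring
  simp_rw [h]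
  have h2 : Tendsto (fun n : ℕ => 1 / (u + n)) atTop (𝓝 0) := by
    simp_rw [one_div]
    exact tendsto_inv_atTop_zero.comp (tendsto_atTop_add_const_left _ _ tendsto_natCast_atTop_atTop)
  simpa using tendsto_const_nhds.sub h2

theorem hasSum_digitProb_tail {r : ℝ} (hr : r ∈ Set.Icc (0 : ℝ) 1) (A : ℕ) :
    HasSum (fun j : ℕ => digitProb r (j + A)) ((1 + r) / (A + 1 + r)) := by
  have h0 := hr.1
  have h := (hasSum_telescope (u := A + 1 + r) (by positivity)).mul_left (1 + r)
  rw [mul_one_div] at h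
  refine h.congr_fun fun j => ?_
  unfold digitProb
  push_cast
  rw [mul_one_div]
  congr 2 <;> ring

theorem hasSum_digitProb {r : ℝ} (hr : r ∈ Set.Icc (0 : ℝ) 1) : HasSum (digitProb r) 1 := by
  have h := hasSum_digitProb_tail hr 0
  have h0 := hr.1
  rwa [Nat.cast_zero, zero_add, div_self (by positivity)] at h

/-- The bound is relative to `digitProb s a`, so that summing over the digits costs only 9·|r - s|.
-/
theorem abs_digitProb_sub_le {r s : ℝ} (hr : r ∈ Set.Icc (0 : ℝ) 1) (hs : s ∈ Set.Icc (0 : ℝ) 1)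
    (a : ℕ) : |digitProb r a - digitProb s a| ≤ 9 * |r - s| * digitProb s a := by
  obtain ⟨hr0, hr1⟩ := hr
  obtain ⟨hs0, hs1⟩ := hs
  have ha : (0 : ℝ) ≤ a := a.cast_nonneg
  have h : digitProb r a - digitProb s a = (r - s) * digitProb s a *
      (((a + 1 + s) * (a + 2 + s) - (1 + s) * (2 * a + 3 + r + s)) /
        ((1 + s) * ((a + 1 + r) * (a + 2 + r)))) := by
    unfold digitProb
    field_simp
    ring
  rw [h, abs_mul, abs_mul, abs_of_nonneg (digitProb_nonneg ⟨hs0, hs1⟩ a), mul_assoc, mul_comm 9,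
    mul_assoc]
  refine mul_le_mul_of_nonneg_left ?_ (abs_nonneg _)
  rw [mul_comm]
  refine mul_le_mul_of_nonneg_right ?_ (digitProb_nonneg ⟨hs0, hs1⟩ a)
  rw [abs_div, abs_of_pos (a := (1 + s) * ((a + 1 + r) * (a + 2 + r))) (by positivity),
    div_le_iff₀ (by positivity), abs_le]
  constructor <;> nlinarith [mul_nonneg ha ha, mul_nonneg ha hr0, mul_nonneg ha hs0,
    mul_nonneg hr0 hs0, mul_nonneg hs0 (mul_nonneg ha ha), mul_nonneg hs0 (mul_nonneg ha hr0),
    mul_nonneg hs0 (mul_nonneg hr0 hr0), mul_nonneg hr0 hr0, mul_nonneg hs0 hs0,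
    mul_nonneg hs0 (sub_nonneg.2 hs1), mul_nonneg ha (sub_nonneg.2 hs1),
    mul_nonneg hr0 (sub_nonneg.2 hs1), mul_nonneg hr0 (sub_nonneg.2 hr1),
    mul_nonneg hs0 (sub_nonneg.2 hr1), mul_nonneg ha (sub_nonneg.2 hr1)]

/-! ### The twisted transfer operator and its Lipschitz bounds -/

/-- The transfer operator of the chain of ratios `q_{n-1} / q_n`, twisted by `(q_{n+1} / q_n)^(it)`. -/
def transfer (t : ℝ) (f : ℝ → ℂ) (r : ℝ) : ℂ :=
  ∑' a : ℕ, (digitProb r a : ℂ) * (twist t (a + 1 + r) * f (nextRatio r a))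

section Transfer

variable {t M : ℝ} {f : ℝ → ℂ}

theorem norm_transfer_term_le (hf : ∀ s ∈ Set.Icc (0 : ℝ) 1, ‖f s‖ ≤ M) {r : ℝ}
    (hr : r ∈ Set.Icc (0 : ℝ) 1) (a : ℕ) :
    ‖(digitProb r a : ℂ) * (twist t (a + 1 + r) * f (nextRatio r a))‖ ≤ digitProb r a * M := by
  rw [norm_mul, norm_mul, norm_twist, one_mul, Complex.norm_real, Real.norm_of_nonneg
    (digitProb_nonneg hr a)]
  exact mul_le_mul_of_nonneg_left (hf _ (nextRatio_mem hr a)) (digitProb_nonneg hr a)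

theorem summable_transfer (hf : ∀ s ∈ Set.Icc (0 : ℝ) 1, ‖f s‖ ≤ M) {r : ℝ}
    (hr : r ∈ Set.Icc (0 : ℝ) 1) :
    Summable fun a : ℕ => (digitProb r a : ℂ) * (twist t (a + 1 + r) * f (nextRatio r a)) :=
  Summable.of_norm_bounded ((hasSum_digitProb hr).summable.mul_right M)
    (norm_transfer_term_le hf hr)

theorem norm_transfer_le (hf : ∀ s ∈ Set.Icc (0 : ℝ) 1, ‖f s‖ ≤ M) {r : ℝ}
    (hr : r ∈ Set.Icc (0 : ℝ) 1) : ‖transfer t f r‖ ≤ M := by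
  have h := (hasSum_digitProb hr).mul_right M
  rw [one_mul] at h
  exact tsum_of_norm_bounded h (norm_transfer_term_le hf hr)

theorem abs_nextRatio_sub_le {r s : ℝ} (hr : r ∈ Set.Icc (0 : ℝ) 1) (hs : s ∈ Set.Icc (0 : ℝ) 1)
    (a : ℕ) : |nextRatio r a - nextRatio s a| ≤ |r - s| * (1 / 4 + if a = 0 then 3 / 4 else 0) := by
  obtain ⟨hr0, hr1⟩ := hr
  obtain ⟨hs0, hs1⟩ := hs
  have h : nextRatio r a - nextRatio s a = -(r - s) * (1 / ((a + 1 + r) * (a + 1 + s))) := by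
    unfold nextRatio
    field_simp
    ring
  rw [h, abs_mul, abs_neg, abs_of_nonneg (a := 1 / ((a + 1 + r) * (a + 1 + s))) (by positivity)]
  refine mul_le_mul_of_nonneg_left ?_ (abs_nonneg _)
  rw [div_le_iff₀ (by positivity)]
  rcases Nat.eq_zero_or_pos a with rfl | ha
  · simp only [Nat.cast_zero, if_true]
    nlinarith [mul_nonneg hr0 hs0]
  · have : (1 : ℝ) ≤ a := by exact_mod_cast ha
    rw [if_neg ha.ne']
    nlinarith [mul_le_mul (show (2 : ℝ) ≤ a + 1 + r by linarith)
      (show (2 : ℝ) ≤ a + 1 + s by linarith) (by norm_num) (by linarith)]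

/-- A Lasota–Yorke inequality. The variation of the weights costs 9, that of the phase |t|. Every
branch contracts by 1/4 except `a = 0`, which has probability at most 1/2, whence 1/4 + (3/4)(1/2) =
5/8 < 1. -/
theorem norm_transfer_sub_le {K : ℝ} (hK : 0 ≤ K) (hf : ∀ s ∈ Set.Icc (0 : ℝ) 1, ‖f s‖ ≤ 1)
    (hf' : ∀ r ∈ Set.Icc (0 : ℝ) 1, ∀ s ∈ Set.Icc (0 : ℝ) 1, ‖f r - f s‖ ≤ K * |r - s|) {r s : ℝ}
    (hr : r ∈ Set.Icc (0 : ℝ) 1) (hs : s ∈ Set.Icc (0 : ℝ) 1) :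
    ‖transfer t f r - transfer t f s‖ ≤ (9 + |t| + 5 / 8 * K) * |r - s| := by
  have hs0 := hs.1
  rw [transfer, transfer, ← (summable_transfer hf hr).tsum_sub (summable_transfer hf hs)]
  set B : ℕ → ℝ := fun a => (9 + |t| + K / 4) * |r - s| * digitProb s a +
    if a = 0 then digitProb s 0 * (K * |r - s| * (3 / 4)) else 0 with hB
  have hBsum : HasSum B ((9 + |t| + K / 4) * |r - s| * 1 +
      digitProb s 0 * (K * |r - s| * (3 / 4))) :=
    ((hasSum_digitProb hs).mul_left _).add (hasSum_ite_eq 0 _)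
  refine (tsum_of_norm_bounded hBsum fun a => ?_).trans ?_
  · have ha : (0 : ℝ) ≤ a := a.cast_nonneg
    have hp := digitProb_nonneg hs a
    have h1 : ‖((digitProb r a - digitProb s a : ℝ) : ℂ) *
        (twist t (a + 1 + r) * f (nextRatio r a))‖ ≤ 9 * |r - s| * digitProb s a := by
      rw [norm_mul, norm_mul, norm_twist, one_mul, Complex.norm_real, Real.norm_eq_abs]
      calc _ ≤ |digitProb r a - digitProb s a| * 1 :=
            mul_le_mul_of_nonneg_left (hf _ (nextRatio_mem hr a)) (abs_nonneg _)
        _ ≤ _ := by rw [mul_one]; exact abs_digitProb_sub_le hr hs a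
    have h2 : ‖(digitProb s a : ℂ) *
        ((twist t (a + 1 + r) - twist t (a + 1 + s)) * f (nextRatio r a))‖ ≤
        digitProb s a * (|t| * |r - s|) := by
      rw [norm_mul, norm_mul, Complex.norm_real, Real.norm_of_nonneg hp]
      refine mul_le_mul_of_nonneg_left ?_ hp
      have := norm_twist_sub_le_of_one_le t (u := a + 1 + r) (v := a + 1 + s)
        (by linarith [hr.1]) (by linarith [hs.1])
      rw [add_sub_add_left_eq_sub] at this
      calc _ ≤ (|t| * |r - s|) * 1 :=
            mul_le_mul this (hf _ (nextRatio_mem hr a)) (norm_nonneg _) (by positivity)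
        _ = _ := mul_one _
    have h3 : ‖(digitProb s a : ℂ) *
        (twist t (a + 1 + s) * (f (nextRatio r a) - f (nextRatio s a)))‖ ≤
        digitProb s a * (K * (|r - s| * (1 / 4 + if a = 0 then 3 / 4 else 0))) := by
      rw [norm_mul, norm_mul, norm_twist, one_mul, Complex.norm_real, Real.norm_of_nonneg hp]
      refine mul_le_mul_of_nonneg_left ?_ hp
      exact (hf' _ (nextRatio_mem hr a) _ (nextRatio_mem hs a)).trans
        (mul_le_mul_of_nonneg_left (abs_nextRatio_sub_le hr hs a) hK)
    have hsplit : (digitProb r a : ℂ) * (twist t (a + 1 + r) * f (nextRatio r a)) -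
        (digitProb s a : ℂ) * (twist t (a + 1 + s) * f (nextRatio s a)) =
        ((digitProb r a - digitProb s a : ℝ) : ℂ) * (twist t (a + 1 + r) * f (nextRatio r a)) +
        (digitProb s a : ℂ) *
          ((twist t (a + 1 + r) - twist t (a + 1 + s)) * f (nextRatio r a)) +
        (digitProb s a : ℂ) *
          (twist t (a + 1 + s) * (f (nextRatio r a) - f (nextRatio s a))) := by
      push_cast
      ring
    rw [hsplit]
    refine (norm_add₃_le.trans (add_le_add_three h1 h2 h3)).trans (le_of_eq ?_)
    rw [hB]
    by_cases h0 : a = 0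
    · subst h0; simp only [if_true]; ring
    · simp only [if_neg h0]; ring
  · have h0 : digitProb s 0 ≤ 1 / 2 := by
      unfold digitProb
      rw [div_le_iff₀ (by positivity)]
      push_cast
      nlinarith
    have h4 : 0 ≤ K * |r - s| * (3 / 4) := by positivity
    nlinarith [mul_le_mul_of_nonneg_right h0 h4]

end Transfer

/-! ### Cancellation over large digits and decay of the iterates -/

/-- A discrete form of d(v^(it-1)) = -(1-it) v^(it-2) dv: up to a relative error O(1/u), the summand
of the tail is a telescoping difference divided by 1 - it. -/
theorem norm_twist_telescope_le {t u : ℝ} (hu : |t| + 1 ≤ u) :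
    ‖(twist t u / u - twist t (u + 1) / (u + 1)) -
      (1 - t * Complex.I) * (twist t u / (u * (u + 1)))‖ ≤
      (t ^ 2 + |t|) / u * (1 / (u * (u + 1))) := by
  have ht := abs_nonneg t
  have hu0 : 0 < u := by linarith
  have hu1 : (u : ℂ) ≠ 0 := by exact_mod_cast hu0.ne'
  have hu2 : (u : ℂ) + 1 ≠ 0 := by exact_mod_cast (by positivity : u + 1 ≠ 0)
  set δ := Real.log (u + 1) - Real.log u with hδ
  have hδ' : δ = Real.log ((u + 1) / u) := (Real.log_div (by positivity) hu0.ne').symm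
  have hδ1 : δ ≤ 1 / u := by
    have h := Real.log_le_sub_one_of_pos (x := (u + 1) / u) (by positivity)
    rw [← hδ', add_div, div_self hu0.ne'] at h
    linarith
  have hδ2 : 1 / u - 1 / u ^ 2 ≤ δ := by
    have h := Real.one_sub_inv_le_log_of_pos (x := (u + 1) / u) (by positivity)
    rw [← hδ'] at h
    refine le_trans ?_ h
    rw [← sub_nonneg]
    have : 1 - ((u + 1) / u)⁻¹ - (1 / u - 1 / u ^ 2) = 1 / (u ^ 2 * (u + 1)) := by
      field_simp
      ring
    rw [this]
    positivity
  have hδ0 : 0 ≤ δ := by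
    refine le_trans ?_ hδ2
    rw [sub_nonneg]
    apply one_div_le_one_div_of_le hu0
    nlinarith
  set E := Complex.exp (Complex.I * (t * δ : ℝ)) with hE
  -- `E` is ((u+1)/u)^(it); the two errors are its quadratic Taylor remainder and the difference
  -- between log(1 + 1/u) and 1/u.
  have hdec : (twist t u / u - twist t (u + 1) / (u + 1)) -
      (1 - t * Complex.I) * (twist t u / (u * (u + 1))) =
      -(twist t u / (u + 1)) * ((E - 1 - Complex.I * (t * δ : ℝ)) +
        Complex.I * (t * (δ - 1 / u) : ℝ)) := by
    rw [twist_eq_mul_exp t (u + 1) u, ← hδ, ← hE]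
    push_cast
    field_simp
    ring
  have htδ : |t * δ| ≤ |t| / u := by
    rw [abs_mul, abs_of_nonneg hδ0, div_eq_mul_one_div]
    exact mul_le_mul_of_nonneg_left hδ1 ht
  have htu : |t| / u ≤ 1 := by
    rw [div_le_one hu0]
    linarith
  have hnorm : ‖Complex.I * ((t * δ : ℝ) : ℂ)‖ = |t * δ| := by
    rw [norm_mul, Complex.norm_I, one_mul, Complex.norm_real, Real.norm_eq_abs]
  have h1 : ‖E - 1 - Complex.I * (t * δ : ℝ)‖ ≤ (|t| / u) ^ 2 := by
    refine (Complex.norm_exp_sub_one_sub_id_le (by rw [hnorm]; exact htδ.trans htu)).trans ?_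
    rw [hnorm]
    gcongr
  have h2 : ‖Complex.I * ((t * (δ - 1 / u) : ℝ) : ℂ)‖ ≤ |t| * (1 / u ^ 2) := by
    rw [norm_mul, Complex.norm_I, one_mul, Complex.norm_real, Real.norm_eq_abs, abs_mul]
    refine mul_le_mul_of_nonneg_left ?_ ht
    rw [abs_le]
    constructor
    · linarith
    · have : 0 ≤ 1 / u ^ 2 := by positivity
      linarith
  have h3 : ‖-(twist t u / ((u : ℂ) + 1))‖ = 1 / (u + 1) := by
    rw [norm_neg, norm_div, norm_twist, ← Complex.ofReal_one, ← Complex.ofReal_add,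
      Complex.norm_real, Real.norm_of_nonneg (by positivity)]
  rw [hdec, norm_mul, h3]
  calc 1 / (u + 1) * _ ≤ 1 / (u + 1) * ((|t| / u) ^ 2 + |t| * (1 / u ^ 2)) :=
        mul_le_mul_of_nonneg_left ((norm_add_le _ _).trans (add_le_add h1 h2)) (by positivity)
    _ = (t ^ 2 + |t|) / u * (1 / (u * (u + 1))) := by
        rw [div_pow, sq_abs]
        field_simp

theorem norm_tsum_twist_le {t u : ℝ} (hu : |t| + 1 ≤ u) :
    ‖1 - t * Complex.I‖ * ‖∑' j : ℕ, twist t (u + j) / ((u + j) * (u + j + 1))‖ ≤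
      (1 + (t ^ 2 + |t|) / u) * (1 / u) := by
  have ht := abs_nonneg t
  have hu0 : 0 < u := by linarith
  have htel := hasSum_telescope hu0
  set T : ℕ → ℂ := fun j => twist t (u + j) / ((u + j) * (u + j + 1)) with hT
  set e : ℕ → ℂ := fun j => (twist t (u + j) / ((u + j : ℝ) : ℂ) -
    twist t (u + j + 1) / ((u + j : ℝ) + 1)) - (1 - t * Complex.I) * T j with he
  have hTsum : Summable T := by
    refine Summable.of_norm_bounded htel.summable fun j => le_of_eq ?_
    have h : ((u : ℂ) + j) * (u + j + 1) = (((u + j) * (u + j + 1) : ℝ) : ℂ) := by push_cast; rfl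
    rw [hT]
    simp only
    rw [h, norm_div, norm_twist, Complex.norm_real, Real.norm_of_nonneg (by positivity)]
  have hebd : ∀ j, ‖e j‖ ≤ (t ^ 2 + |t|) / u * (1 / ((u + j) * (u + j + 1))) := by
    intro j
    have hj : (0 : ℝ) ≤ j := j.cast_nonneg
    have h := norm_twist_telescope_le (t := t) (u := u + j) (by linarith)
    have h' : ‖e j‖ ≤ (t ^ 2 + |t|) / (u + j) * (1 / ((u + j) * (u + j + 1))) := by
      convert h using 2
      simp only [he, hT]
      push_cast
      rfl
    refine h'.trans ?_
    gcongr
    linarith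
  have hesum : HasSum e (∑' j, e j) :=
    (Summable.of_norm_bounded (htel.summable.mul_left _) hebd).hasSum
  have henorm : ‖∑' j, e j‖ ≤ (t ^ 2 + |t|) / u * (1 / u) :=
    tsum_of_norm_bounded (htel.mul_left _) hebd
  set F : ℕ → ℂ := fun j => twist t (u + j) / ((u + j : ℝ) : ℂ) with hF
  have hpart : ∀ n : ℕ, ∑ j ∈ Finset.range n, (e j + (1 - t * Complex.I) * T j) = F 0 - F n := by
    intro n
    rw [← Finset.sum_range_sub']
    refine Finset.sum_congr rfl fun j _ => ?_
    rw [he, hF]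
    push_cast
    rw [add_assoc u, add_assoc (u : ℂ)]
    ring
  have hF0 : Tendsto F atTop (𝓝 0) := by
    rw [tendsto_zero_iff_norm_tendsto_zero]
    have h : ∀ j : ℕ, ‖F j‖ = (u + j)⁻¹ := by
      intro j
      rw [hF]
      simp only
      rw [norm_div, norm_twist, Complex.norm_real, Real.norm_of_nonneg (by positivity), one_div]
    simp_rw [h]
    exact tendsto_inv_atTop_zero.comp (tendsto_atTop_add_const_left _ _ tendsto_natCast_atTop_atTop)
  have hlim := (hesum.add (hTsum.hasSum.mul_left (1 - t * Complex.I))).tendsto_sum_nat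
  have hkey : ∑' j, e j + (1 - t * Complex.I) * ∑' j, T j = F 0 := by
    refine tendsto_nhds_unique hlim ?_
    simp_rw [hpart]
    simpa using tendsto_const_nhds.sub hF0
  have hF0n : ‖F 0‖ = 1 / u := by
    rw [hF]
    simp only [Nat.cast_zero, add_zero]
    rw [norm_div, norm_twist, Complex.norm_real, Real.norm_of_nonneg hu0.le]
  rw [← norm_mul, eq_sub_of_add_eq' hkey]
  calc _ ≤ ‖F 0‖ + ‖∑' j, e j‖ := norm_sub_le _ _
    _ ≤ 1 / u + (t ^ 2 + |t|) / u * (1 / u) := by rw [hF0n]; gcongr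
    _ = _ := by ring

theorem exists_tail_contraction {t : ℝ} (ht : t ≠ 0) :
    ∃ c > 0, ∃ A₀ : ℕ, ∀ A ≥ A₀, ∀ r ∈ Set.Icc (0 : ℝ) 1,
      ‖∑' j : ℕ, (digitProb r (j + A) : ℂ) * twist t ((j + A : ℕ) + 1 + r)‖ ≤
        (1 - c) * ((1 + r) / (A + 1 + r)) := by
  set z := ‖1 - t * Complex.I‖ with hz
  have hz1 : 1 < z := by
    have h : z ^ 2 = 1 + t ^ 2 := by
      rw [hz, ← Complex.normSq_eq_norm_sq, Complex.normSq_apply]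
      simp
      ring
    have : 0 < t ^ 2 := by positivity
    nlinarith [norm_nonneg (1 - t * Complex.I)]
  -- The first bound makes the telescoping estimate applicable; the second brings its error factor 1
  -- + (t² + |t|)/u down to (1 + z)/2, leaving (1 + z)/(2z) = 1 - c after division by z.
  obtain ⟨A₀, hA₀⟩ := exists_nat_ge (max (|t| + 1) (2 * (t ^ 2 + |t|) / (z - 1)))
  refine ⟨(1 - 1 / z) / 2, ?_, A₀, fun A hA r hr => ?_⟩
  · have : 1 / z < 1 := by rw [div_lt_one (by linarith)]; exact hz1
    linarith
  have hr0 := hr.1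
  have hAA : (A₀ : ℝ) ≤ A := by exact_mod_cast hA
  set u : ℝ := A + 1 + r with hu
  have hA0 : (0 : ℝ) ≤ A := A.cast_nonneg
  have hu0 : 0 < u := by positivity
  have hut : |t| + 1 ≤ u := by linarith [le_max_left (|t| + 1) (2 * (t ^ 2 + |t|) / (z - 1))]
  have huc : (t ^ 2 + |t|) / u ≤ (z - 1) / 2 := by
    have h : 2 * (t ^ 2 + |t|) / (z - 1) ≤ u := by
      linarith [le_max_right (|t| + 1) (2 * (t ^ 2 + |t|) / (z - 1))]
    rw [div_le_iff₀ (by linarith)] at h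
    rw [div_le_iff₀ hu0]
    linarith
  have hsum : ∑' j : ℕ, (digitProb r (j + A) : ℂ) * twist t ((j + A : ℕ) + 1 + r) =
      ((1 + r : ℝ) : ℂ) * ∑' j : ℕ, twist t (u + j) / ((u + j) * (u + j + 1)) := by
    rw [← tsum_mul_left]
    congr 1
    ext j
    have h : ((j + A : ℕ) : ℝ) + 1 + r = u + j := by push_cast; ring
    have h' : digitProb r (j + A) = (1 + r) / ((u + j) * (u + j + 1)) := by
      unfold digitProb
      rw [h]
      congr 2
      linarith
    rw [h, h']
    push_cast
    ring
  have hmain := norm_tsum_twist_le hut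
  rw [← hz] at hmain
  rw [hsum, norm_mul, Complex.norm_real, Real.norm_of_nonneg (by positivity), mul_div_assoc',
    mul_comm (1 - _), mul_div_assoc]
  refine mul_le_mul_of_nonneg_left ?_ (by positivity)
  rw [mul_comm z] at hmain
  refine (le_div_iff₀ (by linarith)).2 hmain |>.trans ?_
  rw [mul_one_div, div_div, div_le_div_iff₀ (by positivity) hu0]
  have h : 1 - (1 - 1 / z) / 2 = (z + 1) / (2 * z) := by
    field_simp
    ring
  rw [h]
  have h2 : (z + 1) / (2 * z) * (u * z) = (z + 1) / 2 * u := by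
    field_simp
  rw [h2]
  exact mul_le_mul_of_nonneg_right (by linarith) hu0.le

theorem norm_iterate_transfer_le (t : ℝ) (k : ℕ) {r : ℝ} (hr : r ∈ Set.Icc (0 : ℝ) 1) :
    ‖(transfer t)^[k] 1 r‖ ≤ 1 := by
  induction k generalizing r with
  | zero => simp
  | succ k ih =>
    rw [Function.iterate_succ_apply']
    exact norm_transfer_le (fun s hs => ih hs) hr

/-- The constant is the fixed point of K ↦ 9 + |t| + (5/8)K, hence is preserved by every application
of the operator. -/
theorem norm_iterate_transfer_sub_le (t : ℝ) (k : ℕ) {r s : ℝ} (hr : r ∈ Set.Icc (0 : ℝ) 1)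
    (hs : s ∈ Set.Icc (0 : ℝ) 1) :
    ‖(transfer t)^[k] 1 r - (transfer t)^[k] 1 s‖ ≤ 8 / 3 * (9 + |t|) * |r - s| := by
  induction k generalizing r s with
  | zero => simp; positivity
  | succ k ih =>
    rw [Function.iterate_succ_apply']
    refine (norm_transfer_sub_le (by positivity) (fun s hs => norm_iterate_transfer_le t k hs)
      (fun r hr s hs => ih hr hs) hr hs).trans (le_of_eq ?_)
    ring

/-- Digits below A are bounded trivially. From A on, f is replaced by f(0) at cost K/(A+1), and the
phases then gain the factor 1 - c. These digits have probability p ≥ 1/(A+1); `hcM` makes the gain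
nonnegative, so p may be replaced by this lower bound. -/
theorem norm_transfer_le_sub {t c M K : ℝ} {A : ℕ} {f : ℝ → ℂ} (hK : 0 ≤ K)
    (hA : ∀ r ∈ Set.Icc (0 : ℝ) 1,
      ‖∑' j : ℕ, (digitProb r (j + A) : ℂ) * twist t ((j + A : ℕ) + 1 + r)‖ ≤
        (1 - c) * ((1 + r) / (A + 1 + r)))
    (hcM : K / (A + 1) ≤ c * M)
    (hf : ∀ s ∈ Set.Icc (0 : ℝ) 1, ‖f s‖ ≤ M)
    (hf' : ∀ s ∈ Set.Icc (0 : ℝ) 1, ‖f s - f 0‖ ≤ K * s) {r : ℝ} (hr : r ∈ Set.Icc (0 : ℝ) 1) :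
    ‖transfer t f r‖ ≤ M - 1 / (A + 1) * (c * M - K / (A + 1)) := by
  have hr0 := hr.1
  have hA0 : (0 : ℝ) ≤ A := A.cast_nonneg
  set p : ℝ := (1 + r) / (A + 1 + r) with hp
  have hp0 : 1 / (A + 1) ≤ p := by
    rw [hp, div_le_div_iff₀ (by positivity) (by positivity)]
    nlinarith
  have htail := hasSum_digitProb_tail hr A
  have hhead : ∑ a ∈ Finset.range A, digitProb r a = 1 - p := by
    have := (hasSum_digitProb hr).summable.sum_add_tsum_nat_add A
    rw [htail.tsum_eq, (hasSum_digitProb hr).tsum_eq] at this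
    linarith
  have hsum := summable_transfer (t := t) hf hr
  rw [transfer, ← hsum.sum_add_tsum_nat_add A]
  have h1 : ‖∑ a ∈ Finset.range A,
      (digitProb r a : ℂ) * (twist t (a + 1 + r) * f (nextRatio r a))‖ ≤ (1 - p) * M := by
    rw [← hhead, Finset.sum_mul]
    exact norm_sum_le_of_le _ fun a _ => norm_transfer_term_le hf hr a
  set G : ℕ → ℂ := fun j => (digitProb r (j + A) : ℂ) * twist t ((j + A : ℕ) + 1 + r) with hG
  set H : ℕ → ℂ := fun j => (digitProb r (j + A) : ℂ) *
    (twist t ((j + A : ℕ) + 1 + r) * (f (nextRatio r (j + A)) - f 0)) with hH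
  have hGsum : Summable G := by
    refine Summable.of_norm_bounded htail.summable fun j => le_of_eq ?_
    rw [hG]
    simp only
    rw [norm_mul, norm_twist, mul_one, Complex.norm_real,
      Real.norm_of_nonneg (digitProb_nonneg hr _)]
  have hHbd : ∀ j, ‖H j‖ ≤ digitProb r (j + A) * (K / (A + 1)) := by
    intro j
    rw [hH]
    simp only
    rw [norm_mul, norm_mul, norm_twist, one_mul, Complex.norm_real,
      Real.norm_of_nonneg (digitProb_nonneg hr _)]
    refine mul_le_mul_of_nonneg_left ?_ (digitProb_nonneg hr _)
    refine (hf' _ (nextRatio_mem hr _)).trans ?_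
    rw [div_eq_mul_inv]
    refine mul_le_mul_of_nonneg_left ?_ hK
    unfold nextRatio
    refine inv_anti₀ (by positivity) ?_
    push_cast
    linarith [(j.cast_nonneg : (0 : ℝ) ≤ j)]
  have hHsum : Summable H := Summable.of_norm_bounded (htail.summable.mul_right _) hHbd
  have h2 : ∑' j : ℕ, (digitProb r (j + A) : ℂ) *
      (twist t ((j + A : ℕ) + 1 + r) * f (nextRatio r (j + A))) =
      (∑' j, G j) * f 0 + ∑' j, H j := by
    rw [← tsum_mul_right, ← (hGsum.mul_right _).tsum_add hHsum]
    congr 1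
    ext j
    rw [hG, hH]
    ring
  have h3 : ‖∑' j, G j‖ * ‖f 0‖ ≤ (1 - c) * p * M :=
    mul_le_mul (hA r hr) (hf 0 (by simp)) (norm_nonneg _) ((norm_nonneg _).trans (hA r hr))
  have h4 : ‖∑' j, H j‖ ≤ p * (K / (A + 1)) := tsum_of_norm_bounded (htail.mul_right _) hHbd
  rw [h2]
  calc _ ≤ (1 - p) * M + (‖∑' j, G j‖ * ‖f 0‖ + ‖∑' j, H j‖) := by
        refine (norm_add_le _ _).trans (add_le_add h1 ((norm_add_le _ _).trans ?_))
        rw [norm_mul]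
    _ ≤ (1 - p) * M + ((1 - c) * p * M + p * (K / (A + 1))) := by gcongr
    _ = M - p * (c * M - K / (A + 1)) := by ring
    _ ≤ _ := by
        have := mul_le_mul_of_nonneg_right hp0 (sub_nonneg.2 hcM)
        linarith

/-- The twisted expectations of `q_k ^ (it)` tend to `0` uniformly in the initial ratio. -/
theorem exists_norm_iterate_transfer_le {t : ℝ} (ht : t ≠ 0) {ε : ℝ} (hε : 0 < ε) :
    ∃ k : ℕ, ∀ r ∈ Set.Icc (0 : ℝ) 1, ‖(transfer t)^[k] 1 r‖ ≤ ε := by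
  obtain ⟨c, hc, A₀, hA₀⟩ := exists_tail_contraction ht
  set K := 8 / 3 * (9 + |t|) with hK
  have hK0 : 0 < K := by positivity
  -- Makes the replacement cost K/(A+1) at most half of the gain cε.
  obtain ⟨A₁, hA₁⟩ := exists_nat_ge (2 * K / (c * ε))
  set A := max A₀ A₁ with hA
  have hAA : 2 * K / (c * ε) ≤ A :=
    hA₁.trans (by exact_mod_cast le_max_right A₀ A₁)
  have hA0 : (0 : ℝ) ≤ A := A.cast_nonneg
  have hKA : K / (A + 1) ≤ c * ε / 2 := by
    rw [div_le_iff₀ (by positivity)] at hAA ⊢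
    nlinarith [mul_pos hc hε]
  set δ := 1 / ((A : ℝ) + 1) * (c * ε / 2) with hδ
  have hδ0 : 0 < δ := by positivity
  -- The current bound M never falls below ε, so each step gains at least δ.
  have hmain : ∀ k : ℕ, ∀ r ∈ Set.Icc (0 : ℝ) 1, ‖(transfer t)^[k] 1 r‖ ≤ max ε (1 - k * δ) := by
    intro k
    induction k with
    | zero => intro r hr; simp
    | succ k ih =>
      intro r hr
      rw [Function.iterate_succ_apply']
      set M := max ε (1 - k * δ) with hM
      have hεM : ε ≤ M := le_max_left _ _
      have hcε : c * ε ≤ c * M := mul_le_mul_of_nonneg_left hεM hc.le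
      have hpos : 0 < c * ε := mul_pos hc hε
      have h := norm_transfer_le_sub (t := t) (c := c) (M := M) (K := K) (A := A)
        hK0.le (fun r hr => hA₀ A (le_max_left _ _) r hr) (by linarith) ih
        (fun s hs => by
          have := norm_iterate_transfer_sub_le t k hs (s := 0) (by simp)
          rwa [sub_zero, abs_of_nonneg hs.1] at this) hr
      have h' : δ ≤ 1 / ((A : ℝ) + 1) * (c * M - K / (A + 1)) :=
        mul_le_mul_of_nonneg_left (by linarith) (by positivity)
      refine h.trans ?_
      push_cast
      rcases le_total ε (1 - k * δ) with h1 | h1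
      · rw [hM, max_eq_right h1] at h' ⊢
        refine le_trans ?_ (le_max_right _ _)
        linarith
      · rw [hM, max_eq_left h1] at h' ⊢
        refine le_trans ?_ (le_max_left _ _)
        linarith
  obtain ⟨k, hk⟩ := exists_nat_ge (1 / δ)
  refine ⟨k, fun r hr => (hmain k r hr).trans (max_le le_rfl ?_)⟩
  rw [div_le_iff₀ hδ0] at hk
  linarith

/-! ### The Gauss map and conditioning on the first digit -/

/-- One less than the first partial quotient of `x ∈ (0,1)`. -/
def digit (x : ℝ) : ℕ :=
  ⌊x⁻¹⌋₊ - 1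

/-- The Gauss map. -/
def gaussMap (x : ℝ) : ℝ :=
  Int.fract x⁻¹

theorem measurable_digit : Measurable digit :=
  (measurable_of_countable (fun n : ℕ => n - 1)).comp (Nat.measurable_floor.comp measurable_inv)

theorem measurable_gaussMap : Measurable gaussMap :=
  measurable_fract.comp measurable_inv

theorem digit_inv {y : ℝ} (hy : y ∈ Set.Ico (0 : ℝ) 1) (a : ℕ) : digit (a + 1 + y)⁻¹ = a := by
  have h : ⌊(a : ℝ) + 1 + y⌋₊ = a + 1 := by
    rw [Nat.floor_eq_iff (by linarith [hy.1, (a.cast_nonneg : (0 : ℝ) ≤ a)])]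
    push_cast
    exact ⟨by linarith [hy.1], by linarith [hy.2]⟩
  rw [digit, inv_inv, h, Nat.add_sub_cancel]

theorem gaussMap_inv {y : ℝ} (hy : y ∈ Set.Ico (0 : ℝ) 1) (a : ℕ) :
    gaussMap (a + 1 + y)⁻¹ = y := by
  have h : (a : ℝ) + 1 + y = ((a + 1 : ℕ) : ℝ) + y := by push_cast; ring
  rw [gaussMap, inv_inv, h, Int.fract_natCast_add, Int.fract_eq_self.2 hy]

theorem inv_digit_add_gaussMap {x : ℝ} (hx : x ∈ Set.Ioc (0 : ℝ) 1) :
    x⁻¹ = digit x + 1 + gaussMap x := by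
  have h1 : 1 ≤ x⁻¹ := (one_le_inv₀ hx.1).2 hx.2
  have h2 : 1 ≤ ⌊x⁻¹⌋₊ := Nat.one_le_floor_iff _ |>.2 h1
  have h3 : ((digit x : ℕ) : ℝ) = (⌊x⁻¹⌋₊ : ℝ) - 1 := by
    rw [digit, Nat.cast_sub h2, Nat.cast_one]
  rw [h3, gaussMap, ← Int.self_sub_floor, ← natCast_floor_eq_intCast_floor (by linarith)]
  ring

theorem image_inv_add_Ico (a : ℕ) :
    (fun y : ℝ => ((a : ℝ) + 1 + y)⁻¹) '' Set.Ico 0 1 = Set.Ioc 0 1 ∩ digit ⁻¹' {a} := by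
  have ha : (0 : ℝ) ≤ a := a.cast_nonneg
  ext x
  constructor
  · rintro ⟨y, hy, rfl⟩
    refine ⟨⟨by have := hy.1; positivity, inv_le_one_of_one_le₀ (by linarith [hy.1])⟩,
      digit_inv hy a⟩
  · rintro ⟨hx, rfl⟩
    refine ⟨gaussMap x, ⟨Int.fract_nonneg _, Int.fract_lt_one _⟩, ?_⟩
    simp only
    rw [← inv_digit_add_gaussMap hx, inv_inv]

/-- The conditional law of `T ^ n x` when `q_{n-1} / q_n = r`. -/
def ratioMeasure (r : ℝ) : Measure ℝ :=
  (volume.restrict (Set.Ioo 0 1)).withDensity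
    (fun x => ENNReal.ofReal ((1 + r) / (1 + r * x) ^ 2))

theorem ratioMeasure_zero : ratioMeasure 0 = volume.restrict (Set.Ioo 0 1) := by
  simp [ratioMeasure]

theorem measurable_ratioDensity (r : ℝ) :
    Measurable fun x : ℝ => ENNReal.ofReal ((1 + r) / (1 + r * x) ^ 2) := by
  fun_prop

theorem isProbabilityMeasure_ratioMeasure {r : ℝ} (hr : r ∈ Set.Icc (0 : ℝ) 1) :
    IsProbabilityMeasure (ratioMeasure r) := by
  have hr0 := hr.1
  have hderiv : ∀ x ∈ Set.uIcc (0 : ℝ) 1,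
      HasDerivAt (fun x => (1 + r) * x / (1 + r * x)) ((1 + r) / (1 + r * x) ^ 2) x := by
    intro x hx
    rw [Set.uIcc_of_le zero_le_one] at hx
    have hpos : 0 < 1 + r * x := by have := hx.1; positivity
    have h1 : HasDerivAt (fun x => (1 + r) * x) (1 + r) x := by
      simpa using (hasDerivAt_id x).const_mul (1 + r)
    have h2 : HasDerivAt (fun x => 1 + r * x) r x := by
      simpa using ((hasDerivAt_id x).const_mul r).const_add 1
    exact (h1.div h2 hpos.ne').congr_deriv (by ring)
  have hcont : ContinuousOn (fun x : ℝ => (1 + r) / (1 + r * x) ^ 2) (Set.uIcc 0 1) := by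
    refine ContinuousOn.div (by fun_prop) (by fun_prop) fun x hx => ?_
    rw [Set.uIcc_of_le zero_le_one] at hx
    have := hx.1
    positivity
  have hint : IntervalIntegrable (fun x : ℝ => (1 + r) / (1 + r * x) ^ 2) volume 0 1 :=
    hcont.intervalIntegrable
  have hval := intervalIntegral.integral_eq_sub_of_hasDerivAt hderiv hint
  rw [intervalIntegral.integral_of_le zero_le_one, integral_Ioc_eq_integral_Ioo] at hval
  constructor
  rw [ratioMeasure, withDensity_apply _ MeasurableSet.univ, Measure.restrict_univ,
    ← ofReal_integral_eq_lintegral_ofReal]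
  · rw [hval]
    simp only [mul_one, mul_zero, zero_div, sub_zero]
    rw [div_self (by positivity), ENNReal.ofReal_one]
  · exact (intervalIntegrable_iff_integrableOn_Ioo_of_le zero_le_one).1 hint
  · exact Eventually.of_forall fun x => by positivity

theorem integral_ratioMeasure {E : Type*} [NormedAddCommGroup E] [NormedSpace ℝ E] {r : ℝ}
    (hr : r ∈ Set.Icc (0 : ℝ) 1) (Φ : ℝ → E) :
    ∫ x, Φ x ∂(ratioMeasure r) = ∫ x in Set.Ioo 0 1, ((1 + r) / (1 + r * x) ^ 2) • Φ x := by
  have hr0 := hr.1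
  rw [ratioMeasure, integral_withDensity_eq_integral_toReal_smul (measurable_ratioDensity r)
    (Eventually.of_forall fun x => ENNReal.ofReal_lt_top)]
  congr 1
  ext x
  rw [ENNReal.toReal_ofReal (by positivity)]

/-- Change of variables x = 1/(a+1+y): the density with parameter r times the Jacobian is exactly
`digitProb r a` times the density with parameter `nextRatio r a`. -/
theorem digitProb_smul_integral_ratioMeasure {E : Type*} [NormedAddCommGroup E] [NormedSpace ℝ E]
    {r : ℝ} (hr : r ∈ Set.Icc (0 : ℝ) 1) (Φ : ℝ → E) (a : ℕ) :
    digitProb r a • ∫ y, Φ (a + 1 + y)⁻¹ ∂(ratioMeasure (nextRatio r a)) =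
      ∫ x in Set.Ioc 0 1 ∩ digit ⁻¹' {a}, ((1 + r) / (1 + r * x) ^ 2) • Φ x := by
  have hr0 := hr.1
  have ha : (0 : ℝ) ≤ a := a.cast_nonneg
  rw [← image_inv_add_Ico, integral_image_eq_integral_abs_deriv_smul
    (f' := fun y => -1 / ((a : ℝ) + 1 + y) ^ 2) measurableSet_Ico, integral_Ico_eq_integral_Ioo,
    integral_ratioMeasure (nextRatio_mem hr a), ← integral_smul]
  · refine setIntegral_congr_fun measurableSet_Ioo fun y hy => ?_
    have hy0 := hy.1
    simp only [smul_smul]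
    congr 1
    rw [abs_div, abs_neg, abs_one, abs_of_pos (a := ((a : ℝ) + 1 + y) ^ 2) (by positivity)]
    unfold digitProb nextRatio
    field_simp
    ring
  · intro y hy
    have hy0 := hy.1
    have h : HasDerivAt (fun y => (a : ℝ) + 1 + y) 1 y := by
      simpa using (hasDerivAt_id y).const_add ((a : ℝ) + 1)
    exact (h.inv (by positivity)).hasDerivWithinAt
  · intro y _ z _ h
    simpa using h

/-- The Markov property in integrated form; it takes the place of conditional expectations in the
moment computations. -/
theorem hasSum_integral_ratioMeasure {E : Type*} [NormedAddCommGroup E] [NormedSpace ℝ E] {r : ℝ}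
    (hr : r ∈ Set.Icc (0 : ℝ) 1) {Φ : ℝ → E} (hΦ : Integrable Φ (ratioMeasure r)) :
    HasSum (fun a : ℕ => digitProb r a • ∫ y, Φ (a + 1 + y)⁻¹ ∂(ratioMeasure (nextRatio r a)))
      (∫ x, Φ x ∂(ratioMeasure r)) := by
  have hr0 := hr.1
  have hU : ⋃ a : ℕ, Set.Ioc (0 : ℝ) 1 ∩ digit ⁻¹' {a} = Set.Ioc 0 1 := by
    ext x
    simp
  have hint : IntegrableOn (fun x => ((1 + r) / (1 + r * x) ^ 2) • Φ x) (Set.Ioc 0 1) := by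
    rw [integrableOn_Ioc_iff_integrableOn_Ioo]
    rw [ratioMeasure, integrable_withDensity_iff_integrable_smul' (measurable_ratioDensity r)
      (Eventually.of_forall fun x => ENNReal.ofReal_lt_top)] at hΦ
    refine hΦ.congr (Eventually.of_forall fun x => ?_)
    simp only
    rw [ENNReal.toReal_ofReal (by positivity)]
  have h := hasSum_integral_iUnion
    (fun a => measurableSet_Ioc.inter (measurable_digit (measurableSet_singleton a)))
    (fun a b hab => by
      rw [Function.onFun, Set.disjoint_left]
      rintro x ⟨-, h1⟩ ⟨-, h2⟩
      exact hab (h1.symm.trans h2)) (by rwa [hU])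
  simp_rw [digitProb_smul_integral_ratioMeasure hr]
  rwa [hU, integral_Ioc_eq_integral_Ioo, ← integral_ratioMeasure hr] at h

/-! ### The martingale and its second moment -/

/-- The ratio `q_{n-1} / q_n` after `n` steps, when its initial value is `r`. -/
def ratioSeq : ℕ → ℝ → ℝ → ℝ
  | 0, r, _ => r
  | n + 1, r, x => ratioSeq n (nextRatio r (digit x)) (gaussMap x)

/-- The twisted denominator `q_n ^ (it)`, when the initial ratio is `r`. -/
def twistSeq (t : ℝ) : ℕ → ℝ → ℝ → ℂ
  | 0, _, _ => 1
  | n + 1, r, x =>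
    twist t (digit x + 1 + r) * twistSeq t n (nextRatio r (digit x)) (gaussMap x)

theorem ratioSeq_mem (n : ℕ) {r : ℝ} (hr : r ∈ Set.Icc (0 : ℝ) 1) (x : ℝ) :
    ratioSeq n r x ∈ Set.Icc (0 : ℝ) 1 := by
  induction n generalizing r x with
  | zero => exact hr
  | succ n ih => exact ih (nextRatio_mem hr _) _

theorem norm_twistSeq (t : ℝ) (n : ℕ) (r x : ℝ) : ‖twistSeq t n r x‖ = 1 := by
  induction n generalizing r x with
  | zero => simp [twistSeq]
  | succ n ih => rw [twistSeq, norm_mul, norm_twist, ih, one_mul]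

/-- The martingale with differences
`q_{m+1} ^ (it) g(r_{m+1}) - E[q_{m+1} ^ (it) g(r_{m+1}) | a_1, …, a_m]`. -/
def mart (t : ℝ) (g : ℝ → ℂ) (N : ℕ) (r x : ℝ) : ℂ :=
  ∑ m ∈ Finset.range N, (twistSeq t (m + 1) r x * g (ratioSeq (m + 1) r x) -
    twistSeq t m r x * transfer t g (ratioSeq m r x))

/-- Splitting off the first step rather than the last allows inductions with r varying, each using
only conditioning on one digit. -/
theorem mart_succ (t : ℝ) (g : ℝ → ℂ) (N : ℕ) (r x : ℝ) :
    mart t g (N + 1) r x =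
      (twist t (digit x + 1 + r) * g (nextRatio r (digit x)) - transfer t g r) +
      twist t (digit x + 1 + r) * mart t g N (nextRatio r (digit x)) (gaussMap x) := by
  rw [mart, Finset.sum_range_succ', add_comm, mart, Finset.mul_sum]
  congr 1
  · simp [twistSeq, ratioSeq]
  · refine Finset.sum_congr rfl fun m _ => ?_
    simp only [twistSeq, ratioSeq]
    ring

theorem mart_succ_inv (t : ℝ) (g : ℝ → ℂ) (N : ℕ) (r : ℝ) (a : ℕ) {y : ℝ}
    (hy : y ∈ Set.Ioo (0 : ℝ) 1) :
    mart t g (N + 1) r (a + 1 + y)⁻¹ =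
      (twist t (a + 1 + r) * g (nextRatio r a) - transfer t g r) +
      twist t (a + 1 + r) * mart t g N (nextRatio r a) y := by
  have hy' : y ∈ Set.Ico (0 : ℝ) 1 := ⟨hy.1.le, hy.2⟩
  rw [mart_succ, digit_inv hy', gaussMap_inv hy']

theorem measurable_mart (t : ℝ) (g : ℝ → ℂ) (N : ℕ) (r : ℝ) : Measurable (mart t g N r) := by
  induction N generalizing r with
  | zero =>
    have : mart t g 0 r = fun _ => 0 := by ext x; simp [mart]
    rw [this]
    exact measurable_const
  | succ N ih =>
    have h : mart t g (N + 1) r = (fun p : ℕ × ℝ =>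
        (twist t (p.1 + 1 + r) * g (nextRatio r p.1) - transfer t g r) +
        twist t (p.1 + 1 + r) * mart t g N (nextRatio r p.1) p.2) ∘
        fun x => (digit x, gaussMap x) := by
      ext x
      exact mart_succ t g N r x
    rw [h]
    refine Measurable.comp ?_ (measurable_digit.prodMk measurable_gaussMap)
    refine measurable_from_prod_countable_right fun a => ?_
    exact ((ih (nextRatio r a)).const_mul (twist t (a + 1 + r))).const_add
      (twist t (a + 1 + r) * g (nextRatio r a) - transfer t g r)

section Moments

variable {t : ℝ} {g : ℝ → ℂ}

theorem norm_mart_succ_sub_le (hg : ∀ s ∈ Set.Icc (0 : ℝ) 1, ‖g s‖ ≤ 1) {r : ℝ}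
    (hr : r ∈ Set.Icc (0 : ℝ) 1) (N : ℕ) (x : ℝ) :
    ‖mart t g (N + 1) r x - mart t g N r x‖ ≤ 2 := by
  rw [mart, mart, Finset.sum_range_succ, add_sub_cancel_left]
  refine (norm_sub_le _ _).trans ?_
  rw [norm_mul, norm_mul, norm_twistSeq, norm_twistSeq, one_mul, one_mul]
  linarith [hg _ (ratioSeq_mem (N + 1) hr x), norm_transfer_le (t := t) hg (ratioSeq_mem N hr x)]

theorem norm_mart_le (hg : ∀ s ∈ Set.Icc (0 : ℝ) 1, ‖g s‖ ≤ 1) {r : ℝ}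
    (hr : r ∈ Set.Icc (0 : ℝ) 1) (N : ℕ) (x : ℝ) : ‖mart t g N r x‖ ≤ 2 * N := by
  induction N with
  | zero => simp [mart]
  | succ N ih =>
    have h := norm_add_le (mart t g (N + 1) r x - mart t g N r x) (mart t g N r x)
    rw [sub_add_cancel] at h
    push_cast
    linarith [norm_mart_succ_sub_le (t := t) hg hr N x]

theorem ae_mem_Ioo_ratioMeasure (r : ℝ) : ∀ᵐ y ∂(ratioMeasure r), y ∈ Set.Ioo (0 : ℝ) 1 :=
  (withDensity_absolutelyContinuous _ _).ae_le (ae_restrict_mem measurableSet_Ioo)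

theorem integrable_mart (hg : ∀ s ∈ Set.Icc (0 : ℝ) 1, ‖g s‖ ≤ 1) {r : ℝ}
    (hr : r ∈ Set.Icc (0 : ℝ) 1) (N : ℕ) : Integrable (mart t g N r) (ratioMeasure r) := by
  have := isProbabilityMeasure_ratioMeasure hr
  exact Integrable.of_bound (measurable_mart t g N r).aestronglyMeasurable (2 * N)
    (Eventually.of_forall (norm_mart_le hg hr N))

theorem integrable_norm_mart_sq (hg : ∀ s ∈ Set.Icc (0 : ℝ) 1, ‖g s‖ ≤ 1) {r : ℝ}
    (hr : r ∈ Set.Icc (0 : ℝ) 1) (N : ℕ) :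
    Integrable (fun x => ‖mart t g N r x‖ ^ 2) (ratioMeasure r) := by
  have := isProbabilityMeasure_ratioMeasure hr
  refine Integrable.of_bound ((measurable_mart t g N r).norm.pow_const 2).aestronglyMeasurable
    ((2 * N) ^ 2) (Eventually.of_forall fun x => ?_)
  rw [Real.norm_of_nonneg (by positivity)]
  exact pow_le_pow_left₀ (norm_nonneg _) (norm_mart_le hg hr N x) 2

theorem integral_mart (hg : ∀ s ∈ Set.Icc (0 : ℝ) 1, ‖g s‖ ≤ 1) (N : ℕ) {r : ℝ}
    (hr : r ∈ Set.Icc (0 : ℝ) 1) : ∫ x, mart t g N r x ∂(ratioMeasure r) = 0 := by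
  induction N generalizing r with
  | zero => simp [mart]
  | succ N ih =>
    refine (hasSum_integral_ratioMeasure hr (integrable_mart hg hr (N + 1))).unique ?_
    have hterm : ∀ a : ℕ,
        ∫ y, mart t g (N + 1) r (a + 1 + y)⁻¹ ∂(ratioMeasure (nextRatio r a)) =
          twist t (a + 1 + r) * g (nextRatio r a) - transfer t g r := by
      intro a
      have hs := nextRatio_mem hr a
      have := isProbabilityMeasure_ratioMeasure hs
      rw [integral_congr_ae ((ae_mem_Ioo_ratioMeasure _).mono fun y hy =>
        mart_succ_inv t g N r a hy), integral_add (integrable_const _)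
        ((integrable_mart hg hs N).const_mul _), integral_const_mul, ih hs]
      simp
    simp_rw [hterm]
    have h1 := (summable_transfer (t := t) hg hr).hasSum
    have h2 := (Complex.hasSum_ofReal.2 (hasSum_digitProb hr)).mul_right (transfer t g r)
    have h := h1.sub h2
    simp only [Complex.ofReal_one, one_mul] at h
    have h0 : ∑' a : ℕ, (digitProb r a : ℂ) * (twist t (a + 1 + r) * g (nextRatio r a)) -
        transfer t g r = 0 := sub_self _
    rw [h0] at h
    refine h.congr_fun fun a => ?_
    rw [Complex.real_smul, mul_sub]

theorem integral_norm_const_add_sq {Ω : Type*} [MeasurableSpace Ω] {μ : Measure Ω}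
    [IsProbabilityMeasure μ] {Z : Ω → ℂ} (hZ : Integrable Z μ)
    (hZ2 : Integrable (fun x => ‖Z x‖ ^ 2) μ) (h0 : ∫ x, Z x ∂μ = 0) (c : ℂ) :
    ∫ x, ‖c + Z x‖ ^ 2 ∂μ = ‖c‖ ^ 2 + ∫ x, ‖Z x‖ ^ 2 ∂μ := by
  have hin : Integrable (fun x => 2 * inner ℝ c (Z x)) μ := (hZ.const_inner c).const_mul 2
  simp_rw [norm_add_sq_real]
  rw [integral_add (f := fun x => ‖c‖ ^ 2 + 2 * inner ℝ c (Z x)) ((integrable_const _).add hin) hZ2,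
    integral_add (integrable_const _) hin,
    integral_const_mul, integral_inner hZ, h0]
  simp

/-- Orthogonality of increments: given the first digit, the first increment is a constant of norm at
most 2 and the rest has mean zero, so the squares add. -/
theorem integral_norm_mart_sq_le (hg : ∀ s ∈ Set.Icc (0 : ℝ) 1, ‖g s‖ ≤ 1) (N : ℕ) {r : ℝ}
    (hr : r ∈ Set.Icc (0 : ℝ) 1) : ∫ x, ‖mart t g N r x‖ ^ 2 ∂(ratioMeasure r) ≤ 4 * N := by
  induction N generalizing r with
  | zero => simp [mart]
  | succ N ih =>
    have hsum := hasSum_integral_ratioMeasure hr (integrable_norm_mart_sq (t := t) hg hr (N + 1))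
    have hterm : ∀ a : ℕ,
        ∫ y, ‖mart t g (N + 1) r (a + 1 + y)⁻¹‖ ^ 2 ∂(ratioMeasure (nextRatio r a)) ≤
          4 + 4 * N := by
      intro a
      have hs := nextRatio_mem hr a
      have := isProbabilityMeasure_ratioMeasure hs
      have hnorm : ∀ y, ‖twist t (a + 1 + r) * mart t g N (nextRatio r a) y‖ =
          ‖mart t g N (nextRatio r a) y‖ := fun y => by rw [norm_mul, norm_twist, one_mul]
      rw [integral_congr_ae ((ae_mem_Ioo_ratioMeasure _).mono fun y hy =>
        congrArg (fun z : ℂ => ‖z‖ ^ 2) (mart_succ_inv t g N r a hy))]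
      rw [integral_norm_const_add_sq ((integrable_mart hg hs N).const_mul _)
        (by simp_rw [hnorm]; exact integrable_norm_mart_sq hg hs N)
        (by rw [integral_const_mul, integral_mart hg N hs, mul_zero])]
      simp_rw [hnorm]
      refine add_le_add ?_ (ih hs)
      have hc : ‖twist t (a + 1 + r) * g (nextRatio r a) - transfer t g r‖ ≤ 2 := by
        refine (norm_sub_le _ _).trans ?_
        rw [norm_mul, norm_twist, one_mul]
        linarith [hg _ hs, norm_transfer_le (t := t) hg hr]
      nlinarith [norm_nonneg (twist t (a + 1 + r) * g (nextRatio r a) - transfer t g r)]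
    have h2 := (hasSum_digitProb hr).mul_right (4 + 4 * (N : ℝ))
    rw [one_mul] at h2
    refine (hasSum_le (fun a => ?_) hsum h2).trans (le_of_eq ?_)
    · exact mul_le_mul_of_nonneg_left (hterm a) (digitProb_nonneg hr a)
    · push_cast
      ring

end Moments

/-! ### Almost everywhere convergence of the averages -/

theorem ae_tendsto_zero_of_summable_integral {Ω : Type*} [MeasurableSpace Ω] {μ : Measure Ω}
    {f : ℕ → Ω → ℝ} (hf : ∀ j, Integrable (f j) μ) (h0 : ∀ j x, 0 ≤ f j x) {b : ℕ → ℝ}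
    (hb : Summable b) (hfb : ∀ j, ∫ x, f j x ∂μ ≤ b j) :
    ∀ᵐ x ∂μ, Tendsto (fun j => f j x) atTop (𝓝 0) := by
  have hfin : ∫⁻ x, ∑' j, ENNReal.ofReal (f j x) ∂μ ≠ ⊤ := by
    rw [lintegral_tsum fun j => (hf j).aestronglyMeasurable.aemeasurable.ennreal_ofReal]
    refine ne_top_of_le_ne_top hb.tsum_ofReal_ne_top (ENNReal.tsum_le_tsum fun j => ?_)
    rw [← ofReal_integral_eq_lintegral_ofReal (hf j) (Eventually.of_forall (h0 j))]
    exact ENNReal.ofReal_le_ofReal (hfb j)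
  have hmeas : AEMeasurable (fun x => ∑' j, ENNReal.ofReal (f j x)) μ :=
    AEMeasurable.tsum fun j => (hf j).aestronglyMeasurable.aemeasurable.ennreal_ofReal
  filter_upwards [ae_lt_top' hmeas hfin] with x hx
  have h := ENNReal.tendsto_atTop_zero_of_tsum_ne_top hx.ne
  have h' := (ENNReal.tendsto_toReal ENNReal.zero_ne_top).comp h
  refine h'.congr fun j => ?_
  exact ENNReal.toReal_ofReal (h0 j x)

/-- N exceeds the largest square below it by at most 2√N, so bounded increments cannot disturb the
limit along squares. -/
theorem tendsto_div_of_tendsto_sq {E : Type*} [NormedAddCommGroup E] {C : ℝ} {S : ℕ → E}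
    (hS : ∀ N, ‖S (N + 1) - S N‖ ≤ C)
    (hsq : Tendsto (fun j : ℕ => ‖S (j ^ 2)‖ / (j : ℝ) ^ 2) atTop (𝓝 0)) :
    Tendsto (fun N : ℕ => ‖S N‖ / N) atTop (𝓝 0) := by
  have hC : 0 ≤ C := (norm_nonneg _).trans (hS 0)
  have hdiff : ∀ m k : ℕ, ‖S (m + k)‖ ≤ ‖S m‖ + C * k := by
    intro m k
    induction k with
    | zero => simp
    | succ k ih =>
      have h := norm_add_le (S (m + k + 1) - S (m + k)) (S (m + k))
      rw [sub_add_cancel] at h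
      rw [← add_assoc]
      push_cast
      linarith [hS (m + k)]
  have hsqrt : Tendsto Nat.sqrt atTop atTop :=
    tendsto_atTop_mono' _ (Eventually.of_forall fun _ => le_rfl)
      (tendsto_atTop_atTop.2 fun b => ⟨b ^ 2, fun n hn => Nat.le_sqrt'.2 hn⟩)
  have hlim : Tendsto (fun N : ℕ => ‖S (N.sqrt ^ 2)‖ / (N.sqrt : ℝ) ^ 2 + 2 * C / (N.sqrt : ℝ))
      atTop (𝓝 0) := by
    have h1 := hsq.comp hsqrt
    have h2 := (tendsto_const_div_atTop_nhds_zero_nat (2 * C)).comp hsqrt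
    simpa using h1.add h2
  refine squeeze_zero' (Eventually.of_forall fun N => by positivity) ?_ hlim
  filter_upwards [eventually_ge_atTop 1] with N hN
  have hj : 0 < N.sqrt := Nat.sqrt_pos.2 hN
  have hj' : (0 : ℝ) < N.sqrt := by exact_mod_cast hj
  have h1 : N.sqrt ^ 2 ≤ N := Nat.sqrt_le' N
  have h2 : N - N.sqrt ^ 2 ≤ 2 * N.sqrt := by
    have := Nat.sqrt_le_add N
    rw [pow_two]
    omega
  have h3 := hdiff (N.sqrt ^ 2) (N - N.sqrt ^ 2)
  rw [Nat.add_sub_cancel' h1] at h3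
  have h2' : ((N - N.sqrt ^ 2 : ℕ) : ℝ) ≤ 2 * N.sqrt := by exact_mod_cast h2
  have h1' : (N.sqrt : ℝ) ^ 2 ≤ N := by exact_mod_cast h1
  calc ‖S N‖ / N ≤ (‖S (N.sqrt ^ 2)‖ + C * (2 * N.sqrt)) / (N.sqrt : ℝ) ^ 2 := by
        have h4 := h3.trans (add_le_add_right (mul_le_mul_of_nonneg_left h2' hC) _)
        gcongr
    _ = _ := by
        field_simp

theorem ae_tendsto_div_of_integral_sq_le {Ω : Type*} [MeasurableSpace Ω] {μ : Measure Ω}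
    {S : ℕ → Ω → ℂ} {B C : ℝ} (hS : ∀ N x, ‖S (N + 1) x - S N x‖ ≤ C)
    (hint : ∀ N, Integrable (fun x => ‖S N x‖ ^ 2) μ) (hB : ∀ N : ℕ, ∫ x, ‖S N x‖ ^ 2 ∂μ ≤ B * N) :
    ∀ᵐ x ∂μ, Tendsto (fun N : ℕ => ‖S N x‖ / N) atTop (𝓝 0) := by
  have hsum : Summable fun j : ℕ => B * (1 / (j : ℝ) ^ 2) :=
    (Real.summable_one_div_nat_pow.2 one_lt_two).mul_left B
  have h := ae_tendsto_zero_of_summable_integral (μ := μ)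
    (f := fun j x => ‖S (j ^ 2) x‖ ^ 2 / ((j : ℝ) ^ 2) ^ 2)
    (fun j => (hint _).div_const _) (fun j x => by positivity) hsum (fun j => by
      rw [integral_div]
      rcases Nat.eq_zero_or_pos j with rfl | hj
      · simp
      · have hj' : (0 : ℝ) < j := by exact_mod_cast hj
        rw [div_le_iff₀ (by positivity)]
        refine (hB _).trans (le_of_eq ?_)
        push_cast
        field_simp)
  filter_upwards [h] with x hx
  refine tendsto_div_of_tendsto_sq (fun N => hS N x) ?_
  have h' := hx.sqrt
  rw [Real.sqrt_zero] at h'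
  refine h'.congr fun j => ?_
  rw [← div_pow, Real.sqrt_sq (by positivity)]

/-- Raising j by one changes the sum only by a martingale and two boundary terms. -/
theorem sum_twistSeq_sub (t : ℝ) (j N : ℕ) (r x : ℝ) :
    ∑ m ∈ Finset.range N, twistSeq t m r x * (transfer t)^[j] 1 (ratioSeq m r x) -
      ∑ m ∈ Finset.range N, twistSeq t m r x * (transfer t)^[j + 1] 1 (ratioSeq m r x) =
    mart t ((transfer t)^[j] 1) N r x -
      (twistSeq t N r x * (transfer t)^[j] 1 (ratioSeq N r x) -
        twistSeq t 0 r x * (transfer t)^[j] 1 (ratioSeq 0 r x)) := by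
  rw [← Finset.sum_range_sub fun m => twistSeq t m r x * (transfer t)^[j] 1 (ratioSeq m r x), mart,
    ← Finset.sum_sub_distrib, ← Finset.sum_sub_distrib]
  refine Finset.sum_congr rfl fun m _ => ?_
  rw [Function.iterate_succ_apply']
  ring

theorem ae_tendsto_sum_twistSeq {t : ℝ} (ht : t ≠ 0) :
    ∀ᵐ x ∂(volume.restrict (Set.Ioo (0 : ℝ) 1)),
      Tendsto (fun N : ℕ => ‖∑ m ∈ Finset.range N, twistSeq t m 0 x‖ / N) atTop (𝓝 0) := by
  have h0 : (0 : ℝ) ∈ Set.Icc (0 : ℝ) 1 := by simp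
  have hmart : ∀ᵐ x ∂(volume.restrict (Set.Ioo (0 : ℝ) 1)), ∀ j : ℕ,
      Tendsto (fun N : ℕ => ‖mart t ((transfer t)^[j] 1) N 0 x‖ / N) atTop (𝓝 0) := by
    rw [← ratioMeasure_zero, ae_all_iff]
    intro j
    have hg : ∀ s ∈ Set.Icc (0 : ℝ) 1, ‖(transfer t)^[j] 1 s‖ ≤ 1 :=
      fun s hs => norm_iterate_transfer_le t j hs
    exact ae_tendsto_div_of_integral_sq_le (fun N x => norm_mart_succ_sub_le hg h0 N x)
      (fun N => integrable_norm_mart_sq hg h0 N) (fun N => integral_norm_mart_sq_le hg N h0)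
  filter_upwards [hmart] with x hx
  set Z : ℕ → ℕ → ℂ := fun j N =>
    ∑ m ∈ Finset.range N, twistSeq t m 0 x * (transfer t)^[j] 1 (ratioSeq m 0 x) with hZ
  have hterm : ∀ j m, ‖twistSeq t m 0 x * (transfer t)^[j] 1 (ratioSeq m 0 x)‖ ≤ 1 := by
    intro j m
    rw [norm_mul, norm_twistSeq, one_mul]
    exact norm_iterate_transfer_le t j (ratioSeq_mem m h0 x)
  have hstep : ∀ j, Tendsto (fun N : ℕ => ‖Z j N - Z (j + 1) N‖ / N) atTop (𝓝 0) := by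
    intro j
    have hlim := (hx j).add (tendsto_const_div_atTop_nhds_zero_nat (2 : ℝ))
    rw [add_zero] at hlim
    refine squeeze_zero (fun N => by positivity) (fun N => ?_) hlim
    rw [← add_div]
    refine div_le_div_of_nonneg_right ?_ N.cast_nonneg
    simp only [hZ]
    rw [sum_twistSeq_sub]
    refine (norm_sub_le _ _).trans (add_le_add le_rfl ((norm_sub_le _ _).trans ?_))
    linarith [hterm j N, hterm j 0]
  have hdiff : ∀ k, Tendsto (fun N : ℕ => ‖Z 0 N - Z k N‖ / N) atTop (𝓝 0) := by
    intro k
    induction k with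
    | zero => simp
    | succ k ih =>
      have hlim := ih.add (hstep k)
      rw [add_zero] at hlim
      refine squeeze_zero (fun N => by positivity) (fun N => ?_) hlim
      rw [← add_div]
      refine div_le_div_of_nonneg_right ?_ N.cast_nonneg
      exact norm_sub_le_norm_sub_add_norm_sub _ _ _
  have hZ0 : ∀ N, Z 0 N = ∑ m ∈ Finset.range N, twistSeq t m 0 x := fun N => by simp [hZ]
  simp_rw [← hZ0]
  rw [Metric.tendsto_atTop]
  intro ε hε
  -- k is fixed before N: only finitely many martingales intervene between `Z 0` and `Z k`, and `Z k
  -- N` is trivially at most Nε/2.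
  obtain ⟨k, hk⟩ := exists_norm_iterate_transfer_le ht (half_pos hε)
  obtain ⟨N₀, hN₀⟩ := Metric.tendsto_atTop.1 (hdiff k) (ε / 2) (half_pos hε)
  refine ⟨max N₀ 1, fun N hN => ?_⟩
  have hN1 : (0 : ℝ) < N := by exact_mod_cast (le_max_right N₀ 1).trans hN
  have h1 := hN₀ N ((le_max_left _ _).trans hN)
  rw [Real.dist_0_eq_abs, abs_of_nonneg (by positivity)] at h1 ⊢
  have h2 : ‖Z k N‖ / N ≤ ε / 2 := by
    rw [div_le_iff₀ hN1, mul_comm]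
    refine (norm_sum_le_of_le _ fun m _ => ?_).trans (le_of_eq ?_) (b := ∑ m ∈ Finset.range N, ε / 2)
    · rw [norm_mul, norm_twistSeq, one_mul]
      exact hk _ (ratioSeq_mem m h0 x)
    · simp
  have h3 : ‖Z 0 N‖ ≤ ‖Z 0 N - Z k N‖ + ‖Z k N‖ := by
    have := norm_add_le (Z 0 N - Z k N) (Z k N)
    rwa [sub_add_cancel] at this
  calc ‖Z 0 N‖ / N ≤ ‖Z 0 N - Z k N‖ / N + ‖Z k N‖ / N := by
        rw [← add_div]; exact div_le_div_of_nonneg_right h3 hN1.le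
    _ < ε := by linarith

/-! ### Identification with the convergent denominators -/

/-- Stated for any solution of the recurrence, with r in the role of D_{-1}/D_0, because the
induction shifts D by one, which turns r into D_0/D_1 = `nextRatio r (digit x)`. -/
theorem pos_and_twist_eq_twistSeq (t : ℝ) (n : ℕ) {D : ℕ → ℝ} {r x : ℝ}
    (hr : r ∈ Set.Icc (0 : ℝ) 1) (hD0 : 0 < D 0) (hD1 : D 1 = (digit x + 1 + r) * D 0)
    (hD : ∀ n, D (n + 2) = (digit (gaussMap^[n + 1] x) + 1) * D (n + 1) + D n) :
    0 < D n ∧ twist t (D n) = twist t (D 0) * twistSeq t n r x := by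
  induction n generalizing D r x with
  | zero => simp [twistSeq, hD0]
  | succ n ih =>
    have hr0 := hr.1
    have hpos : (0 : ℝ) < digit x + 1 + r := by positivity
    have h := ih (D := fun m => D (m + 1)) (x := gaussMap x) (nextRatio_mem hr (digit x))
      (by simp only [zero_add]; rw [hD1]; positivity)
      (by
        simp only [zero_add]
        rw [hD 0, zero_add, Function.iterate_one, hD1]
        unfold nextRatio
        field_simp)
      (fun m => by simp only [hD (m + 1), Function.iterate_succ_apply])
    refine ⟨h.1, ?_⟩
    rw [h.2]
    simp only [zero_add, twistSeq]
    rw [hD1, twist_mul t hpos.ne' hD0.ne']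
    ring

theorem get?_of_s_eq_digit {v : ℝ} (hv : Irrational v) (n : ℕ) :
    (GenContFract.of v).s.get? n =
      some ⟨1, (digit (gaussMap^[n] (Int.fract v)) : ℝ) + 1⟩ := by
  induction n generalizing v with
  | zero =>
    have hfr : Int.fract v ≠ 0 := by
      intro h
      exact hv ⟨⌊v⌋, by rw [Rat.cast_intCast]; linarith [Int.floor_add_fract v]⟩
    have hpos : 0 < Int.fract v := (Int.fract_nonneg v).lt_of_ne' hfr
    have hx : Int.fract v ∈ Set.Ioc (0 : ℝ) 1 := ⟨hpos, (Int.fract_lt_one v).le⟩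
    have h := GenContFract.of_s_head hfr
    rw [Stream'.Seq.head] at h
    rw [h, Function.iterate_zero, id]
    congr 2
    have h2 := inv_digit_add_gaussMap hx
    have h3 : gaussMap (Int.fract v) = (Int.fract v)⁻¹ - ⌊(Int.fract v)⁻¹⌋ := rfl
    linarith
  | succ n ih =>
    have hfr : Irrational (Int.fract v)⁻¹ := by
      rw [irrational_inv_iff, ← Int.self_sub_floor]
      exact hv.sub_intCast _
    rw [GenContFract.of_s_succ, ih hfr]
    rfl

theorem convDen_pos_and_twist (t : ℝ) {x : ℝ} (hx : x ∈ Set.Ioo (0 : ℝ) 1) (hirr : Irrational x)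
    (n : ℕ) : 0 < convDen x n ∧ twist t (convDen x n) = twistSeq t n 0 x := by
  have hfr : Int.fract x = x := Int.fract_eq_self.2 ⟨hx.1.le, hx.2⟩
  have hs : ∀ n, (GenContFract.of x).s.get? n = some ⟨1, (digit (gaussMap^[n] x) : ℝ) + 1⟩ := by
    intro n
    rw [get?_of_s_eq_digit hirr, hfr]
  have h0 : convDen x 0 = 1 := GenContFract.zeroth_den_eq_one
  have h := pos_and_twist_eq_twistSeq t n (D := convDen x) (r := 0) (x := x) (by simp)
    (by rw [h0]; exact one_pos)
    (by
      rw [h0, mul_one, add_zero]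
      exact GenContFract.first_den_eq (hs 0))
    (fun m => by
      have := GenContFract.dens_recurrence (hs (m + 1)) (ppredB := convDen x m) rfl
        (predB := convDen x (m + 1)) rfl
      rw [one_mul] at this
      exact this)
  rwa [h0, twist_one, one_mul] at h

theorem ae_tendsto_sum_twist_convDen {t : ℝ} (ht : t ≠ 0) :
    ∀ᵐ x ∂(volume.restrict (Set.Ioo (0 : ℝ) 1)),
      Tendsto (fun N : ℕ => ‖∑ n ∈ Finset.Icc 1 N, twist t (convDen x n)‖ / N) atTop (𝓝 0) := by
  have hirr : ∀ᵐ x ∂(volume.restrict (Set.Ioo (0 : ℝ) 1)), Irrational x :=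
    ae_restrict_of_ae ((Set.countable_range ((↑) : ℚ → ℝ)).ae_notMem volume)
  filter_upwards [ae_tendsto_sum_twistSeq ht, hirr, ae_restrict_mem measurableSet_Ioo]
    with x hx hxi hx01
  have hlim := hx.add (tendsto_const_div_atTop_nhds_zero_nat (2 : ℝ))
  rw [add_zero] at hlim
  refine squeeze_zero (fun N => by positivity) (fun N => ?_) hlim
  rw [← add_div]
  refine div_le_div_of_nonneg_right ?_ N.cast_nonneg
  -- The index ranges 1..N and 0..N-1 differ by two terms of norm 1, whence the 2/N above.
  have heq : ∑ n ∈ Finset.Icc 1 N, twist t (convDen x n) =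
      ∑ m ∈ Finset.range N, twistSeq t m 0 x + (twistSeq t N 0 x - twistSeq t 0 0 x) := by
    rw [← Finset.sum_range_sub fun m => twistSeq t m 0 x, ← Finset.sum_add_distrib,
      Finset.range_eq_Ico, Finset.sum_Ico_eq_sum_range, ← Finset.Ico_add_one_right_eq_Icc,
      Finset.sum_Ico_eq_sum_range]
    refine Finset.sum_congr (by simp) fun m _ => ?_
    rw [(convDen_pos_and_twist t hx01 hxi _).2, add_comm 1 m, zero_add]
    ring
  rw [heq]
  refine (norm_add_le _ _).trans (add_le_add le_rfl ((norm_sub_le _ _).trans ?_))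
  rw [norm_twistSeq, norm_twistSeq]
  norm_num

/-! ### Weyl's criterion through weak convergence on the circle -/

/-- The uniform probability measure on the classes mod `1` of `u 1, …, u (N + 1)`. -/
def empiricalMeasure (u : ℕ → ℝ) (N : ℕ) : Measure UnitAddCircle :=
  ((N + 1 : ℕ) : ENNReal)⁻¹ •
    ∑ n ∈ Finset.Icc 1 (N + 1), Measure.dirac ((u n : ℝ) : UnitAddCircle)

instance isProbabilityMeasure_empiricalMeasure (u : ℕ → ℝ) (N : ℕ) :
    IsProbabilityMeasure (empiricalMeasure u N) := by
  constructor
  rw [empiricalMeasure, Measure.smul_apply, Measure.finsetSum_apply]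
  simp only [measure_univ, Finset.sum_const, Nat.card_Icc, smul_eq_mul, nsmul_eq_mul, mul_one,
    Nat.add_sub_cancel]
  exact ENNReal.inv_mul_cancel (by positivity) (ENNReal.natCast_ne_top _)

theorem integral_empiricalMeasure (u : ℕ → ℝ) (N : ℕ) (f : C(UnitAddCircle, ℂ)) :
    ∫ y, f y ∂(empiricalMeasure u N) =
      (∑ n ∈ Finset.Icc 1 (N + 1), f ((u n : ℝ) : UnitAddCircle)) / (N + 1 : ℕ) := by
  rw [empiricalMeasure, integral_smul_measure, integral_finsetSum_measure]
  · simp_rw [integral_dirac]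
    rw [ENNReal.toReal_inv, ENNReal.toReal_natCast, Complex.real_smul, div_eq_inv_mul]
    push_cast
    rfl
  · intro n _
    exact integrable_dirac (by simp)

theorem integrable_continuousMap {μ : Measure UnitAddCircle} [IsFiniteMeasure μ]
    (f : C(UnitAddCircle, ℂ)) : Integrable f μ :=
  (BoundedContinuousFunction.mkOfCompact f).integrable μ

theorem norm_integral_continuousMap_sub_le {μ : Measure UnitAddCircle} [IsProbabilityMeasure μ]
    (f g : C(UnitAddCircle, ℂ)) : ‖∫ y, f y ∂μ - ∫ y, g y ∂μ‖ ≤ ‖f - g‖ := by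
  rw [← integral_sub (integrable_continuousMap f) (integrable_continuousMap g)]
  refine (norm_integral_le_of_norm_le_const (C := ‖f - g‖)
    (Eventually.of_forall fun y => ?_)).trans (by simp)
  exact (f - g).norm_coe_le_norm y

theorem tendsto_integral_of_tendsto_fourier {μ : ℕ → Measure UnitAddCircle} {ν : Measure UnitAddCircle}
    [∀ N, IsProbabilityMeasure (μ N)] [IsProbabilityMeasure ν]
    (h : ∀ k : ℤ, Tendsto (fun N => ∫ y, fourier k y ∂(μ N)) atTop
      (𝓝 (∫ y : UnitAddCircle, fourier k y ∂ν)))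
    (f : C(UnitAddCircle, ℂ)) : Tendsto (fun N => ∫ y, f y ∂(μ N)) atTop (𝓝 (∫ y, f y ∂ν)) := by
  have hspan : ∀ p ∈ Submodule.span ℂ (Set.range (@fourier (1 : ℝ))),
      Tendsto (fun N => ∫ y, p y ∂(μ N)) atTop (𝓝 (∫ y, p y ∂ν)) := by
    intro p hp
    induction hp using Submodule.span_induction with
    | mem p hp =>
      obtain ⟨k, rfl⟩ := hp
      exact h k
    | zero => simp
    | add p q _ _ hp hq =>
      simp only [ContinuousMap.add_apply]
      simp_rw [integral_add (integrable_continuousMap p) (integrable_continuousMap q)]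
      exact hp.add hq
    | smul c p _ hp =>
      simp only [ContinuousMap.smul_apply, integral_smul]
      exact hp.const_smul c
  rw [Metric.tendsto_atTop]
  intro ε hε
  have hf : f ∈ (Submodule.span ℂ (Set.range (@fourier (1 : ℝ)))).topologicalClosure := by
    rw [span_fourier_closure_eq_top]
    exact Submodule.mem_top
  obtain ⟨p, hp, hfp⟩ := Metric.mem_closure_iff.1 hf (ε / 3) (by positivity)
  rw [dist_eq_norm] at hfp
  obtain ⟨N₀, hN₀⟩ := Metric.tendsto_atTop.1 (hspan p hp) (ε / 3) (by positivity)
  refine ⟨N₀, fun N hN => ?_⟩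
  have h1 := norm_integral_continuousMap_sub_le (μ := μ N) f p
  have h2 := norm_integral_continuousMap_sub_le (μ := ν) f p
  have h3 := hN₀ N hN
  rw [← dist_eq_norm] at h1 h2
  have h4 := dist_triangle4_right (∫ y, f y ∂(μ N)) (∫ y, f y ∂ν) (∫ y, p y ∂(μ N)) (∫ y, p y ∂ν)
  linarith

theorem integral_fourier_eq_zero {k : ℤ} (hk : k ≠ 0) :
    ∫ y : UnitAddCircle, fourier k y = 0 :=
  integral_eq_zero_of_add_right_eq_neg (fourier_add_half_inv_index hk one_pos)

/-- The arc [0,t] is viewed as a ball, so that ready formulas for its volume and its null boundary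
apply. -/
theorem coe_mem_closedBall_iff {t : ℝ} (ht : t ∈ Set.Ico (0 : ℝ) 1) (y : ℝ) :
    (y : UnitAddCircle) ∈ Metric.closedBall ((t / 2 : ℝ) : UnitAddCircle) (t / 2) ↔
      Int.fract y ≤ t := by
  rw [Metric.mem_closedBall, dist_eq_norm, ← AddCircle.coe_sub, UnitAddCircle.norm_eq]
  constructor
  · intro h
    rw [abs_le] at h
    have h1 : Int.fract y = y - round (y - t / 2) := by
      rw [Int.fract_eq_iff]
      exact ⟨by linarith, by linarith [ht.2], round (y - t / 2), by ring⟩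
    rw [h1]
    linarith
  · intro h
    refine (round_le (y - t / 2) ⌊y⌋).trans ?_
    have h1 := Int.self_sub_floor y
    rw [abs_le]
    constructor <;> linarith [Int.fract_nonneg y]

/-- Weyl's criterion. -/
theorem isUnifDistribModOne_of_tendsto_exp {u : ℕ → ℝ}
    (h : ∀ k : ℤ, k ≠ 0 → Tendsto (fun N : ℕ =>
      ‖∑ n ∈ Finset.Icc 1 N, Complex.exp (2 * Real.pi * Complex.I * k * u n)‖ / N) atTop (𝓝 0)) :
    IsUnifDistribModOne u := by
  have hprob : IsProbabilityMeasure (volume : Measure UnitAddCircle) := ⟨UnitAddCircle.measure_univ⟩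
  have hfour : ∀ k : ℤ, Tendsto (fun N => ∫ y, fourier k y ∂(empiricalMeasure u N)) atTop
      (𝓝 (∫ y : UnitAddCircle, fourier k y)) := by
    intro k
    rcases eq_or_ne k 0 with rfl | hk
    · simp
    · rw [integral_fourier_eq_zero hk, tendsto_zero_iff_norm_tendsto_zero]
      refine ((tendsto_add_atTop_iff_nat 1).2 (h k hk)).congr fun N => ?_
      rw [integral_empiricalMeasure, norm_div, Complex.norm_natCast]
      congr 2
      refine Finset.sum_congr rfl fun n _ => ?_
      rw [fourier_coe_apply]
      simp
  set P : ℕ → ProbabilityMeasure UnitAddCircle := fun N => ⟨empiricalMeasure u N, inferInstance⟩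
  set ν : ProbabilityMeasure UnitAddCircle := ⟨volume, hprob⟩
  have hweak : Tendsto P atTop (𝓝 ν) := by
    rw [ProbabilityMeasure.tendsto_iff_forall_integral_rclike_tendsto ℂ]
    intro f
    exact tendsto_integral_of_tendsto_fourier hfour f.toContinuousMap
  intro t ht
  set B : Set UnitAddCircle := Metric.closedBall ((t / 2 : ℝ) : UnitAddCircle) (t / 2) with hB
  have hfront : volume (frontier B) = 0 := by
    have hsub : frontier B ⊆ B \ Metric.ball ((t / 2 : ℝ) : UnitAddCircle) (t / 2) := by
      rw [hB, Metric.isClosed_closedBall.frontier_eq]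
      exact Set.sdiff_subset_sdiff_right Metric.ball_subset_interior_closedBall
    refine measure_mono_null hsub ?_
    exact (ae_le_set.1 AddCircle.closedBall_ae_eq_ball.le)
  have hlim := ProbabilityMeasure.tendsto_measure_of_null_frontier_of_tendsto' hweak hfront
  have hvol : volume B = ENNReal.ofReal t := by
    rw [hB, AddCircle.volume_closedBall, mul_div_cancel₀ _ two_ne_zero, min_eq_right ht.2.le]
  have hνB : (ν : Measure UnitAddCircle) B = ENNReal.ofReal t := hvol
  have hlim' := (ENNReal.tendsto_toReal (measure_ne_top (ν : Measure UnitAddCircle) B)).comp hlim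
  rw [hνB, ENNReal.toReal_ofReal ht.1] at hlim'
  -- `empiricalMeasure u N` carries N + 1 points, so the counting sequence is shifted by one.
  rw [← tendsto_add_atTop_iff_nat 1]
  refine hlim'.congr fun N => ?_
  simp only [Function.comp, P, ProbabilityMeasure.coe_mk]
  rw [empiricalMeasure, Measure.smul_apply, Measure.finsetSum_apply, smul_eq_mul,
    ENNReal.toReal_mul, ENNReal.toReal_inv, ENNReal.toReal_natCast, div_eq_inv_mul]
  congr 1
  have hterm : ∀ n, Measure.dirac ((u n : ℝ) : UnitAddCircle) B =
      if Int.fract (u n) ≤ t then 1 else 0 := by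
    intro n
    rw [Measure.dirac_apply' _ Metric.isClosed_closedBall.measurableSet]
    split_ifs with hn
    · exact Set.indicator_of_mem ((coe_mem_closedBall_iff ht _).2 hn) _
    · exact Set.indicator_of_notMem (fun hmem => hn ((coe_mem_closedBall_iff ht _).1 hmem)) _
  simp_rw [hterm]
  rw [Finset.sum_boole, ENNReal.toReal_natCast]

/-! ### Significands and conclusion -/

theorem significand_le_iff {x t : ℝ} (hx : 0 < x) (ht : t ∈ Set.Ico (1 : ℝ) 10) :
    significand x ≤ t ↔ Int.fract (Real.logb 10 x) ≤ Real.logb 10 t := by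
  obtain ⟨⟨h1, h2⟩, k, hk⟩ := (significand_eq_iff hx.ne' (significand x)).1 rfl
  rw [abs_of_pos hx] at hk
  have hs : 0 < significand x := by linarith
  have hfr : Int.fract (Real.logb 10 x) = Real.logb 10 (significand x) := by
    rw [Int.fract_eq_iff]
    refine ⟨Real.logb_nonneg (by norm_num) h1, ?_, k, ?_⟩
    · rw [Real.logb_lt_iff_lt_rpow (by norm_num) hs, Real.rpow_one]
      exact h2
    · nth_rewrite 1 [hk]
      rw [Real.logb_mul (by positivity) hs.ne', ← Real.rpow_intCast,
        Real.logb_rpow (by norm_num) (by norm_num)]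
      ring
  rw [hfr, Real.logb_le_logb (by norm_num) hs (by linarith [ht.1])]

theorem isBenford_iff_of_pos {u : ℕ → ℝ} (hu : ∀ n, 0 < u n) :
    IsBenford u ↔ IsUnifDistribModOne fun n => Real.logb 10 (u n) := by
  constructor
  · intro h t ht
    have hpow : (10 : ℝ) ^ t ∈ Set.Ico (1 : ℝ) 10 := by
      refine ⟨Real.one_le_rpow (by norm_num) ht.1, ?_⟩
      nth_rewrite 2 [← Real.rpow_one 10]
      exact Real.rpow_lt_rpow_of_exponent_lt (by norm_num) ht.2
    have hlog : Real.logb 10 ((10 : ℝ) ^ t) = t := Real.logb_rpow (by norm_num) (by norm_num)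
    have h' := h _ hpow
    simp_rw [significand_le_iff (hu _) hpow] at h'
    rwa [hlog] at h'
  · intro h t ht
    have hmem : Real.logb 10 t ∈ Set.Ico (0 : ℝ) 1 := by
      refine ⟨Real.logb_nonneg (by norm_num) ht.1, ?_⟩
      rw [Real.logb_lt_iff_lt_rpow (by norm_num) (by linarith [ht.1]), Real.rpow_one]
      exact ht.2
    simp_rw [significand_le_iff (hu _) ht]
    exact h _ hmem

theorem ae_isUnifDistribModOne_mul_log_convDen {c : ℝ} (hc : c ≠ 0) :
    ∀ᵐ x ∂(volume.restrict (Set.Ioo (0 : ℝ) 1)),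
      IsUnifDistribModOne fun n => c * Real.log (convDen x n) := by
  have h : ∀ᵐ x ∂(volume.restrict (Set.Ioo (0 : ℝ) 1)), ∀ k : ℤ, k ≠ 0 →
      Tendsto (fun N : ℕ =>
        ‖∑ n ∈ Finset.Icc 1 N, twist (2 * Real.pi * k * c) (convDen x n)‖ / N) atTop (𝓝 0) := by
    rw [ae_all_iff]
    intro k
    by_cases hk : k = 0
    · exact Eventually.of_forall fun x h => absurd hk h
    · have hk' : (k : ℝ) ≠ 0 := by exact_mod_cast hk
      filter_upwards [ae_tendsto_sum_twist_convDen (t := 2 * Real.pi * k * c)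
        (by have := Real.pi_ne_zero; positivity)] with x hx _ using hx
  filter_upwards [h] with x hx
  refine isUnifDistribModOne_of_tendsto_exp fun k hk => (hx k hk).congr fun N => ?_
  congr 2
  refine Finset.sum_congr rfl fun n _ => ?_
  rw [twist]
  congr 1
  push_cast
  ring

theorem theorem1 :
    (∀ᵐ x : ℝ ∂(MeasureTheory.volume.restrict (Set.Ioo (0 : ℝ) 1)),
      IsBenford (fun n => convDen x n)) ∧
    (∀ᵐ x : ℝ ∂(MeasureTheory.volume.restrict (Set.Ioo (0 : ℝ) 1)),
      IsUnifDistribModOne (fun n => Real.logb 10 (convDen x n))) ∧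
    (∀ x ∈ Set.Ioo (0 : ℝ) 1, Irrational x →
      (IsBenford (fun n => convDen x n) ↔
        IsUnifDistribModOne (fun n => Real.logb 10 (convDen x n)))) ∧
    (∀ᵐ x : ℝ ∂(MeasureTheory.volume.restrict (Set.Ioo (0 : ℝ) 1)),
      IsUnifDistribModOne (fun n => Real.log (convDen x n))) := by
  have hiff : ∀ x ∈ Set.Ioo (0 : ℝ) 1, Irrational x →
      (IsBenford (fun n => convDen x n) ↔
        IsUnifDistribModOne (fun n => Real.logb 10 (convDen x n))) :=
    -- Only positivity of the denominators is needed; the parameter 0 is arbitrary.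
    fun x hx hirr => isBenford_iff_of_pos fun n => (convDen_pos_and_twist 0 hx hirr n).1
  have hud : ∀ᵐ x : ℝ ∂(MeasureTheory.volume.restrict (Set.Ioo (0 : ℝ) 1)),
      IsUnifDistribModOne (fun n => Real.logb 10 (convDen x n)) := by
    have h10 : Real.log 10 ≠ 0 := (Real.log_pos (by norm_num)).ne'
    filter_upwards [ae_isUnifDistribModOne_mul_log_convDen (inv_ne_zero h10)] with x hx
    simpa only [Real.logb, div_eq_inv_mul] using hx
  have hirr : ∀ᵐ x ∂(volume.restrict (Set.Ioo (0 : ℝ) 1)), Irrational x :=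
    ae_restrict_of_ae ((Set.countable_range ((↑) : ℚ → ℝ)).ae_notMem volume)
  refine ⟨?_, hud, hiff, ?_⟩
  · filter_upwards [hud, hirr, ae_restrict_mem measurableSet_Ioo] with x hx hxi hx01
    exact (hiff x hx01 hxi).2 hx
  · simpa only [one_mul] using ae_isUnifDistribModOne_mul_log_convDen one_ne_zero

end
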